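/- **Setting.** Let $\mathcal S(\mathbb R^d)$ be the real Schwartz space, $\mathcal S'(\mathbb R^d)$ its dual, and $\mathcal M(\mathbb R^d)=(C_0(\mathbb R^d))'$ the space of finite real Borel measures with the total-variation norm $\|\cdot\|_{\mathcal M}$. For $n\in\mathbb N$ let $L_{\infty,n}(\mathbb R^d)$ be the space of (classes of) measurable functions $f$ with $\operatorname{ess\,sup}_{x}|f(x)|(1+\|x\|)^{-n}<\infty$. Let $\mathrm L$ be a linear shift-invariant operator, given on test functions by $\mathrm L:\mathcal S(\mathbb R^d)\to\mathcal S'(\mathbb R^d)$, whose adjoint $\mathrm L^*$ maps test functions to locally integrable functions, and extended to functions $f$ by duality: $\mathrm Lf=w\in\mathcal M(\mathbb R^d)$ means that $f\cdot \mathrm L^*\varphi$ is integrable and $\int f\,\mathrm L^*\varphi\,dx=\int\varphi\,dw$ for every $\varphi\in\mathcal S(\mathbb R^d)$. Assume: 1. $\mathrm L$ is spline-admissible: there is a function $\rho_{\mathrm L}:\mathbb R^d\to\mathbb R$ of slow growth with $\mathrm L\rho_{\mathrm L}=\delta$; with $n_0=\inf\{n\in\mathbb N:\rho_{\mathrm L}\in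 L_{\infty,n}(\mathbb R^d)\}$, the native space $\mathcal M_{\mathrm L}(\mathbb R^d)=\{f\in L_{\infty,n_0}(\mathbb R^d):\mathrm Lf\in\mathcal M(\mathbb R^d)\}$ contains $\mathcal S(\mathbb R^d)$; and the null space $\mathcal N_{\mathrm L}=\{q\in L_{\infty,n_0}(\mathbb R^d):\mathrm Lq=0\}$ has finite dimension $N_0\ge 0$. Let $p_1,\dots,p_{N_0}$ be a basis of $\mathcal N_{\mathrm L}$ and let $\phi_1,\dots,\phi_{N_0}$ be linear functionals on $\mathcal M_{\mathrm L}(\mathbb R^d)$ with $\phi_i(p_j)=\delta_{ij}$. 2. $\boldsymbol\nu:\mathcal M_{\mathrm L}(\mathbb R^d)\to\mathbb R^M$ is linear and weak*-continuous, that is, continuous for the topology of pointwise convergence on $C_{\mathrm L}(\mathbb R^d)=\mathrm L^*(C_0(\mathbb R^d))+\operatorname{span}\{\phi_1,\dots,\phi_{N_0}\}$, where $u\in C_0(\mathbb R^d)$ acts through $\langle \mathrm L^*u,f\rangle=\int u\,d(\mathrm Lf)$. 3. For $q_1,q_2\in\mathcal N_{\mathrm L}$: $\boldsymbol\nu(q_1)=\boldsymbol\nu(q_2)\Leftrightarrow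 q_1=q_2$. **Theorem 2 (generalized spline interpolant).** Let $\mathbf y\in\mathbb R^M$ be such that $\boldsymbol\nu(f)=\mathbf y$ for some $f\in\mathcal M_{\mathrm L}(\mathbb R^d)$, and let $\mathcal V$ be the set of solutions of $$\min_{f\in\mathcal M_{\mathrm L}(\mathbb R^d)}\|\mathrm Lf\|_{\mathcal M}\quad\text{s.t.}\quad\boldsymbol\nu(f)=\mathbf y .$$ Then $\mathcal V$ has extreme points, and every extreme point $s$ of $\mathcal V$ is a nonuniform $\mathrm L$-spline $$s(x)=\sum_{k=1}^K a_k\,\rho_{\mathrm L}(x-x_k)+\sum_{n=1}^{N_0}b_n\,p_n(x)\quad\text{for almost every }x,$$ with $K\le M-N_0$, distinct knots $x_k\in\mathbb R^d$, and $a_k,b_n\in\mathbb R$; moreover $\mathrm Ls=\sum_{k=1}^K a_k\,\delta(\cdot-x_k)$, and the minimum value is $\|\mathrm Ls\|_{\mathcal M}=\sum_{k=1}^K|a_k|$. -/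

import Mathlib

open MeasureTheory Set
open scoped SchwartzMap ZeroAtInfty

noncomputable section

namespace GTV

/-- The domain `ℝ^d`, with its Euclidean norm. -/
abbrev Space (d : ℕ) : Type := EuclideanSpace ℝ (Fin d)

/-- Real tempered distributions on `ℝ^d`: continuous linear functionals on the real Schwartz
space. -/
abbrev Tempered (d : ℕ) : Type := 𝓢(Space d, ℝ) →L[ℝ] ℝ

/-- The space `M(ℝ^d)` of real-valued, countably additive Borel measures on `ℝ^d` (all of them are
finite and regular). -/
abbrev Meas (d : ℕ) : Type := SignedMeasure (Space d)

/-- The norm of `M(ℝ^d)`: the total variation of the whole space. -/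
def normM {d : ℕ} (w : Meas d) : ℝ := w.totalVariation.real univ

/-- The Dirac impulse `δ(· - x)`. -/
def diracM {d : ℕ} (x : Space d) : Meas d := VectorMeasure.dirac x (1 : ℝ)

/-- `f ∈ L_{∞,n}(ℝ^d)`: the function `f` is measurable and `|f(x)| (1 + ‖x‖)^{-n}` is essentially
bounded. -/
def MemWeighted {d : ℕ} (n : ℕ) (f : Space d → ℝ) : Prop :=
  AEStronglyMeasurable f volume ∧ ∃ C : ℝ, ∀ᵐ x ∂volume, |f x| ≤ C * (1 + ‖x‖) ^ n

/-- The rate of polynomial growth `inf {n ∈ ℕ : ρ ∈ L_{∞,n}(ℝ^d)}` of `ρ` (meaningful for `ρ` of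
slow growth). -/
def growthOrder {d : ℕ} (ρ : Space d → ℝ) : ℕ := sInf {n : ℕ | MemWeighted n ρ}

/-- The function `g` is the image `L*φ` of the test function `φ` under the adjoint of the operator
`L : S → S'`, that is, `⟨g, ψ⟩ = ⟨Lψ, φ⟩` for all test functions `ψ`. -/
def IsAdjointAt {d : ℕ} (L : 𝓢(Space d, ℝ) →ₗ[ℝ] Tempered d) (φ : 𝓢(Space d, ℝ))
    (g : Space d → ℝ) : Prop :=
  LocallyIntegrable g volume ∧
    ∀ ψ : 𝓢(Space d, ℝ), Integrable (fun x => ψ x * g x) volume ∧ ∫ x, ψ x * g x = L ψ φ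

/-- A linear shift-invariant operator, given by its action `S → S'` on test functions, whose adjoint
maps test functions to functions. The last field is no restriction: if `L : S → S'` is continuous
and shift-invariant, then it is the convolution with a tempered distribution, and `L*φ` is a smooth
function of slow growth. -/
structure LSIOperator (d : ℕ) where
  /-- the action on test functions -/
  toLin : 𝓢(Space d, ℝ) →ₗ[ℝ] Tempered d
  /-- `L{ψ(· - a)} = L{ψ}(· - a)` as tempered distributions -/
  shift : ∀ (a : Space d) (ψ φ : 𝓢(Space d, ℝ)),
    toLin (SchwartzMap.compSubConstCLM ℝ a ψ) φ = toLin ψ (SchwartzMap.compSubConstCLM ℝ (-a) φ)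
  /-- `L*φ` is a function -/
  adjoint : ∀ φ : 𝓢(Space d, ℝ), ∃ g : Space d → ℝ, IsAdjointAt toLin φ g

/-- `Lf = w` in the sense of distributions, for a function `f` and a measure `w`. The operator `L`,
given on test functions, acts on functions by duality, `⟨Lf, φ⟩ = ⟨f, L*φ⟩`, whenever the
integrals on the right converge. (The function `L*φ` is unique up to null sets.) -/
def HasImage {d : ℕ} (L : LSIOperator d) (f : Space d → ℝ) (w : Meas d) : Prop :=
  ∀ φ : 𝓢(Space d, ℝ), ∃ g : Space d → ℝ, IsAdjointAt L.toLin φ g ∧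
    Integrable (fun x => f x * g x) volume ∧ ∫ x, f x * g x = ∫ᵛ x, φ x ∂<•w

/-- `f` belongs to `L_{∞,n}(ℝ^d)` and `Lf` is a finite measure. -/
def MemNative {d : ℕ} (L : LSIOperator d) (n : ℕ) (f : Space d → ℝ) : Prop :=
  MemWeighted n f ∧ ∃ w : Meas d, HasImage L f w

section Basics

variable {d : ℕ}

instance instFiniteVariation (w : Meas d) : IsFiniteMeasure w.variation := by
  rw [← SignedMeasure.totalVariation_eq_variation]
  infer_instance

lemma integrable_schwartz (w : Meas d) (φ : 𝓢(Space d, ℝ)) : w.Integrable φ :=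
  φ.toBoundedContinuousFunction.integrable w.variation

lemma integrable_zeroAtInfty (w : Meas d) (u : C₀(Space d, ℝ)) : w.Integrable u :=
  u.toBCF.integrable w.variation

lemma integral_eq_jordan (w : Meas d) (φ : 𝓢(Space d, ℝ)) :
    ∫ᵛ x, φ x ∂<•w = ∫ x, φ x ∂w.toJordanDecomposition.posPart
      - ∫ x, φ x ∂w.toJordanDecomposition.negPart := by
  conv_lhs => rw [← w.toSignedMeasure_toJordanDecomposition, JordanDecomposition.toSignedMeasure]
  rw [VectorMeasure.integral_sub_vectorMeasure (integrable_schwartz _ φ) (integrable_schwartz _ φ),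
    VectorMeasure.integral_toSignedMeasure, VectorMeasure.integral_toSignedMeasure]

/-- A finite measure is determined by its action on test functions. -/
lemma meas_eq_zero (w : Meas d) (h : ∀ φ : 𝓢(Space d, ℝ), ∫ᵛ x, φ x ∂<•w = 0) : w = 0 := by
  classical
  obtain ⟨S, hS, hpS, hnS⟩ := w.toJordanDecomposition.mutuallySingular
  set P := w.toJordanDecomposition.posPart with hP
  set N := w.toJordanDecomposition.negPart with hN
  let f : Space d → ℝ := fun x => if x ∈ S then -1 else 1
  have hfm : Measurable f := Measurable.ite hS measurable_const measurable_const
  have hfb : ∀ x, ‖f x‖ ≤ 1 := by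
    intro x
    by_cases hx : x ∈ S <;> simp [f, hx]
  have hfP : f =ᵐ[P] fun _ => 1 := by
    have : ∀ᵐ x ∂P, x ∉ S := by simpa [ae_iff] using hpS
    filter_upwards [this] with x hx
    simp [f, hx]
  have hfN : f =ᵐ[N] fun _ => -1 := by
    have : ∀ᵐ x ∂N, x ∈ S := by
      rw [ae_iff]
      exact hnS
    filter_upwards [this] with x hx
    simp [f, hx]
  have hint : Integrable f (P + N) :=
    Integrable.of_bound hfm.aestronglyMeasurable 1 (Filter.Eventually.of_forall hfb)
  have key : ∀ᵐ x ∂(P + N), f x = 0 := by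
    refine ae_eq_zero_of_integral_contDiff_smul_eq_zero hint.locallyIntegrable ?_
    intro g hg hgc
    have h0 := h (hgc.toSchwartzMap hg)
    rw [integral_eq_jordan] at h0
    have hi : ∀ μ : Measure (Space d), [IsFiniteMeasure μ] → Integrable (fun x => g x • f x) μ := by
      intro μ _
      have h1 : Integrable f μ :=
        Integrable.of_bound hfm.aestronglyMeasurable 1 (Filter.Eventually.of_forall hfb)
      exact h1.locallyIntegrable.integrable_smul_left_of_hasCompactSupport hg.continuous hgc
    rw [integral_add_measure (hi P) (hi N)]
    have e1 : ∫ x, g x • f x ∂P = ∫ x, g x ∂P := by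
      apply integral_congr_ae
      filter_upwards [hfP] with x hx
      simp [hx]
    have e2 : ∫ x, g x • f x ∂N = - ∫ x, g x ∂N := by
      rw [← integral_neg]
      apply integral_congr_ae
      filter_upwards [hfN] with x hx
      simp [hx]
    rw [e1, e2]
    simpa [sub_eq_add_neg] using h0
  have hz : P + N = 0 := by
    have : ∀ᵐ x ∂(P + N), False := by
      filter_upwards [key] with x hx
      by_cases hxS : x ∈ S <;> simp [f, hxS] at hx
    exact ae_eq_bot.1 (Filter.eventually_false_iff_eq_bot.1 this)
  have hV : w.totalVariation = 0 := hz
  ext i _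
  exact w.null_of_totalVariation_zero (by simp [hV])

lemma IsAdjointAt.ae_eq {L : 𝓢(Space d, ℝ) →ₗ[ℝ] Tempered d} {φ : 𝓢(Space d, ℝ)}
    {g₁ g₂ : Space d → ℝ} (h₁ : IsAdjointAt L φ g₁) (h₂ : IsAdjointAt L φ g₂) :
    g₁ =ᵐ[volume] g₂ := by
  refine ae_eq_of_integral_contDiff_smul_eq h₁.1 h₂.1 ?_
  intro g hg hgc
  have e₁ := (h₁.2 (hgc.toSchwartzMap hg)).2
  have e₂ := (h₂.2 (hgc.toSchwartzMap hg)).2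
  simpa using e₁.trans e₂.symm

lemma HasImage.unique {L : LSIOperator d} {f : Space d → ℝ} {w₁ w₂ : Meas d}
    (h₁ : HasImage L f w₁) (h₂ : HasImage L f w₂) : w₁ = w₂ := by
  rw [← sub_eq_zero]
  apply meas_eq_zero
  intro φ
  obtain ⟨g₁, ha₁, -, e₁⟩ := h₁ φ
  obtain ⟨g₂, ha₂, -, e₂⟩ := h₂ φ
  rw [VectorMeasure.integral_sub_vectorMeasure (integrable_schwartz _ φ) (integrable_schwartz _ φ), ← e₁, ← e₂,
    sub_eq_zero]
  apply integral_congr_ae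
  filter_upwards [ha₁.ae_eq ha₂] with x hx
  simp [hx]

lemma HasImage.congr {L : LSIOperator d} {f f' : Space d → ℝ} {w : Meas d}
    (h : HasImage L f w) (hf : f =ᵐ[volume] f') : HasImage L f' w := by
  intro φ
  obtain ⟨g, ha, hi, e⟩ := h φ
  have hfg : (fun x => f x * g x) =ᵐ[volume] fun x => f' x * g x := by
    filter_upwards [hf] with x hx
    simp [hx]
  exact ⟨g, ha, hi.congr hfg, (integral_congr_ae hfg).symm.trans e⟩

lemma HasImage.add {L : LSIOperator d} {f₁ f₂ : Space d → ℝ} {w₁ w₂ : Meas d}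
    (h₁ : HasImage L f₁ w₁) (h₂ : HasImage L f₂ w₂) :
    HasImage L (fun x => f₁ x + f₂ x) (w₁ + w₂) := by
  intro φ
  obtain ⟨g, ha, hi₁, e₁⟩ := h₁ φ
  obtain ⟨g₂, ha₂, hi₂, e₂⟩ := h₂ φ
  have hg : (fun x => f₂ x * g₂ x) =ᵐ[volume] fun x => f₂ x * g x := by
    filter_upwards [ha₂.ae_eq ha] with x hx
    simp [hx]
  have hi₂' := hi₂.congr hg
  refine ⟨g, ha, (hi₁.add hi₂').congr (Filter.Eventually.of_forall fun x => ?_), ?_⟩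
  · simp [add_mul]
  · rw [VectorMeasure.integral_add_vectorMeasure (integrable_schwartz _ φ) (integrable_schwartz _ φ), ← e₁, ← e₂,
      integral_congr_ae hg, ← integral_add hi₁ hi₂']
    simp [add_mul]

lemma HasImage.smul {L : LSIOperator d} {f : Space d → ℝ} {w : Meas d}
    (h : HasImage L f w) (c : ℝ) : HasImage L (fun x => c * f x) (c • w) := by
  intro φ
  obtain ⟨g, ha, hi, e⟩ := h φ
  refine ⟨g, ha, (hi.const_mul c).congr (Filter.Eventually.of_forall fun x => ?_), ?_⟩
  · simp [mul_assoc]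
  · rw [VectorMeasure.integral_smul_vectorMeasure, ← e, smul_eq_mul, ← integral_const_mul]
    simp [mul_assoc]

lemma MemWeighted.congr {n : ℕ} {f f' : Space d → ℝ} (h : MemWeighted n f)
    (hf : f =ᵐ[volume] f') : MemWeighted n f' := by
  obtain ⟨hm, C, hC⟩ := h
  refine ⟨hm.congr hf, C, ?_⟩
  filter_upwards [hC, hf] with x hx hfx
  rwa [← hfx]

lemma MemWeighted.add {n : ℕ} {f₁ f₂ : Space d → ℝ} (h₁ : MemWeighted n f₁)
    (h₂ : MemWeighted n f₂) : MemWeighted n (fun x => f₁ x + f₂ x) := by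
  obtain ⟨hm₁, C₁, hC₁⟩ := h₁
  obtain ⟨hm₂, C₂, hC₂⟩ := h₂
  refine ⟨hm₁.add hm₂, C₁ + C₂, ?_⟩
  filter_upwards [hC₁, hC₂] with x hx₁ hx₂
  rw [add_mul]
  exact (abs_add_le _ _).trans (add_le_add hx₁ hx₂)

lemma MemWeighted.smul {n : ℕ} {f : Space d → ℝ} (h : MemWeighted n f) (c : ℝ) :
    MemWeighted n (fun x => c * f x) := by
  obtain ⟨hm, C, hC⟩ := h
  refine ⟨hm.const_mul c, |c| * C, ?_⟩
  filter_upwards [hC] with x hx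
  rw [abs_mul, mul_assoc]
  exact mul_le_mul_of_nonneg_left hx (abs_nonneg c)

lemma MemWeighted.zero (n : ℕ) : MemWeighted n (fun _ : Space d => (0 : ℝ)) :=
  ⟨aestronglyMeasurable_const, 0, by simp⟩

lemma HasImage.zero (L : LSIOperator d) : HasImage L (fun _ => 0) 0 := by
  intro φ
  obtain ⟨g, hg⟩ := L.adjoint φ
  exact ⟨g, hg, by simp, by simp⟩

end Basics

/-- The native space `M_L(ℝ^d) = {f ∈ L_{∞,n}(ℝ^d) : ‖Lf‖_M < ∞}`, where functions that agree
almost everywhere are identified. -/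
def nativeSpace {d : ℕ} (L : LSIOperator d) (n : ℕ) : Submodule ℝ (Space d →ₘ[volume] ℝ) where
  carrier := {f | MemNative L n f}
  zero_mem' :=
    ⟨(MemWeighted.zero n).congr (AEEqFun.coeFn_zero (β := ℝ)).symm, 0,
      (HasImage.zero L).congr (AEEqFun.coeFn_zero (β := ℝ)).symm⟩
  add_mem' := by
    rintro f₁ f₂ ⟨h₁, w₁, i₁⟩ ⟨h₂, w₂, i₂⟩
    exact ⟨(h₁.add h₂).congr (AEEqFun.coeFn_add f₁ f₂).symm, w₁ + w₂,
      (i₁.add i₂).congr (AEEqFun.coeFn_add f₁ f₂).symm⟩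
  smul_mem' := by
    rintro c f ⟨h, w, i⟩
    exact ⟨(h.smul c).congr (AEEqFun.coeFn_smul c f).symm, c • w,
      (i.smul c).congr (AEEqFun.coeFn_smul c f).symm⟩

/-- The operator `L : M_L(ℝ^d) → M(ℝ^d)`. -/
def opL {d : ℕ} (L : LSIOperator d) (n : ℕ) : nativeSpace L n →ₗ[ℝ] Meas d where
  toFun f := f.2.2.choose
  map_add' f₁ f₂ := by
    refine HasImage.unique (f₁ + f₂).2.2.choose_spec ?_
    exact (f₁.2.2.choose_spec.add f₂.2.2.choose_spec).congr
      (AEEqFun.coeFn_add f₁.1 f₂.1).symm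
  map_smul' c f := by
    refine HasImage.unique (c • f).2.2.choose_spec ?_
    exact (f.2.2.choose_spec.smul c).congr (AEEqFun.coeFn_smul c f.1).symm

lemma hasImage_opL {d : ℕ} (L : LSIOperator d) (n : ℕ) (f : nativeSpace L n) :
    HasImage L (f : Space d →ₘ[volume] ℝ) (opL L n f) :=
  f.2.2.choose_spec

/-- The null space `N_L = {q ∈ L_{∞,n}(ℝ^d) : Lq = 0}`. -/
def nullSpace {d : ℕ} (L : LSIOperator d) (n : ℕ) : Submodule ℝ (nativeSpace L n) :=
  LinearMap.ker (opL L n)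

/-- The regularization functional `gTV(f) = ‖Lf‖_M`. -/
def gTV {d : ℕ} (L : LSIOperator d) (n : ℕ) (f : nativeSpace L n) : ℝ := normM (opL L n f)

/-- The (shift-invariant) operator `L` is spline-admissible, with Green's function `ρ`. -/
structure IsSplineAdmissible {d : ℕ} (L : LSIOperator d) (ρ : Space d → ℝ) : Prop where
  /-- the native space contains the test functions -/
  schwartz : ∀ ψ : 𝓢(Space d, ℝ), MemNative L (growthOrder ρ) ψ
  /-- `ρ` is a function of slow growth -/
  slow_growth : ∃ n : ℕ, MemWeighted n ρ
  /-- `Lρ = δ` -/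
  green : HasImage L ρ (diracM 0)
  /-- the growth-restricted null space is finite-dimensional -/
  finite_null : FiniteDimensional ℝ (nullSpace L (growthOrder ρ))

/-- The adjoint `L* : C₀(ℝ^d) → (M_L(ℝ^d))'`, `⟨L*u, f⟩ = ∫ u d(Lf)`. -/
def adjointC0 {d : ℕ} (L : LSIOperator d) (n : ℕ) :
    C₀(Space d, ℝ) →ₗ[ℝ] Module.Dual ℝ (nativeSpace L n) where
  toFun u :=
    { toFun := fun f => ∫ᵛ x, u x ∂<•(opL L n f)
      map_add' := fun f₁ f₂ => by
        rw [map_add, VectorMeasure.integral_add_vectorMeasure (integrable_zeroAtInfty _ u)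
          (integrable_zeroAtInfty _ u)]
      map_smul' := fun c f => by
        rw [map_smul, VectorMeasure.integral_smul_vectorMeasure, RingHom.id_apply] }
  map_add' u v := by
    ext f
    exact VectorMeasure.integral_fun_add (integrable_zeroAtInfty _ u) (integrable_zeroAtInfty _ v)
  map_smul' c u := by
    ext f
    simpa using VectorMeasure.integral_fun_smul (opL L n f) (ContinuousLinearMap.lsmul ℝ ℝ).flip c u

/-- `(φ, p)` is a biorthogonal system for the null space: `p` is a basis of `N_L`, and `φ_i(p_j)` is
`1` for `i = j` and `0` otherwise. -/
def IsBiorthogonal {d N₀ : ℕ} {L : LSIOperator d} {n : ℕ}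
    (φ : Fin N₀ → Module.Dual ℝ (nativeSpace L n))
    (p : Module.Basis (Fin N₀) ℝ (nullSpace L n)) : Prop :=
  ∀ i j, φ i (p j : nativeSpace L n) = if i = j then 1 else 0

/-- The predual `C_L(ℝ^d) = L*(C₀(ℝ^d)) + span {φ_1, …, φ_{N₀}}`, as a space of linear functionals
on `M_L(ℝ^d)`. -/
def predual {d N₀ : ℕ} (L : LSIOperator d) (n : ℕ)
    (φ : Fin N₀ → Module.Dual ℝ (nativeSpace L n)) :
    Submodule ℝ (Module.Dual ℝ (nativeSpace L n)) :=
  LinearMap.range (adjointC0 L n) ⊔ Submodule.span ℝ (range φ)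

/-- The weak* topology of `M_L(ℝ^d) = (C_L(ℝ^d))'`: the topology of pointwise convergence on
`C_L(ℝ^d)`. -/
@[reducible] def weakStar {d N₀ : ℕ} (L : LSIOperator d) (n : ℕ)
    (φ : Fin N₀ → Module.Dual ℝ (nativeSpace L n)) : TopologicalSpace (nativeSpace L n) :=
  TopologicalSpace.induced (fun f => fun ℓ : predual L n φ => (ℓ : Module.Dual ℝ _) f)
    Pi.topologicalSpace

/-- The solutions of the interpolation problem: the minimizers of `‖Lf‖_M` among the
`f ∈ M_L(ℝ^d)` with `ν(f) = y`. -/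
def solutionSet {d M : ℕ} (L : LSIOperator d) (n : ℕ) (ν : nativeSpace L n →ₗ[ℝ] (Fin M → ℝ))
    (y : Fin M → ℝ) : Set (nativeSpace L n) :=
  {f | ν f = y ∧ ∀ g : nativeSpace L n, ν g = y → gTV L n f ≤ gTV L n g}

end GTV

end

noncomputable section

open Filter Topology
open scoped ContDiff Pointwise

namespace GTV

/-! By weak*-continuity each component of `ν f` is a moment `∫ u d(Lf)`, with `u` in `C₀`, plus a
combination of the `φ_j(f)`, and that combination is the same component of `ν` at the null-space
element `∑ φ_j(f) p_j`. A projection `T` with kernel `ν(N_L)` therefore turns the problem into one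
about measures: minimize the norm of `w = Lf` with `T` of the moments of `w` prescribed
(`exists_moment_constraint`).

Existence. As the `u_i` vanish at infinity, the moment vectors of `±δ_x`, together with `0`, form a
compact set in `ℝ^M`. By Hahn–Banach its convex hull, dilated by the norm of `w`, contains the
moments of `w`; conversely every point of the hull comes from a finitely supported measure of norm
at most one. So the minimum over all measures is attained on some finite set `F`
(`exists_finite_minimizer`), and it lifts to `M_L` because `δ_x` is the image of `ρ(· - x)`.
Minimizers carried by `F` form a compact set in `ℝ^F`, which has an extreme point. A lift of it is
extreme among all solutions: equality in the triangle inequality keeps any decomposition on `F`, and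
`ν` is injective on `N_L`.

Form of extreme points. Let `s` be extreme and `w = Ls`. Surround `k` points of the support of `w`
by disjoint bounded neighbourhoods `A_i`, and lift the restrictions of `w` to the `A_i` to functions
`f_i`. If a combination `g` of the `f_i` and `p_j` satisfies `ν g = 0`, then for small `ε` the norm
at `s ± εg` is at most affine in the sign; minimality makes both points solutions, and extremality
gives `g = 0`. Hence `k + N₀ ≤ M`, the support is finite, and `s` differs from a combination of
translates of `ρ` by an element of `N_L`.

The analytic difficulty is the lift of a restriction by convolution with `ρ`: Fubini needs `∫ |ρ(x -
y) (L*φ)(x)| dx` bounded uniformly for `y` in a ball, whereas `Lρ = δ` gives only finiteness for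
each `y`. The closed graph theorem and uniform boundedness on an `ℓ¹` space of superpositions of
translates of `φ` supply the bound (`exists_integral_translate_le`). -/

/-- In a finite-dimensional space, the convex hull of a compact set is compact. -/
theorem isCompact_convexHull {E : Type*} [NormedAddCommGroup E] [NormedSpace ℝ E]
    [FiniteDimensional ℝ E] {D : Set E} (hD : IsCompact D) : IsCompact (convexHull ℝ D) := by
  rcases D.eq_empty_or_nonempty with rfl | ⟨e₀, he₀⟩
  · simp
  -- Carathéodory: `dim E + 1` points suffice, so the hull is a continuous image of a compact set.
  set m := Module.finrank ℝ E + 1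
  let Φ : (Fin m → ℝ) × (Fin m → E) → E := fun q => ∑ i, q.1 i • q.2 i
  have hΦ : Continuous Φ := by fun_prop
  have hK : IsCompact (stdSimplex ℝ (Fin m) ×ˢ Set.univ.pi fun _ : Fin m => D) :=
    (isCompact_stdSimplex ℝ (Fin m)).prod (isCompact_univ_pi fun _ => hD)
  have heq : convexHull ℝ D = Φ '' (stdSimplex ℝ (Fin m) ×ˢ Set.univ.pi fun _ : Fin m => D) := by
    apply Subset.antisymm
    · intro x hx
      obtain ⟨ι, _, z, w, hz, hzi, hw, hw1, rfl⟩ := eq_pos_convex_span_of_mem_convexHull hx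
      have hcard : Fintype.card ι ≤ Fintype.card (Fin m) := by
        rw [Fintype.card_fin]
        exact hzi.card_le_finrank_succ.trans (by
          have := Submodule.finrank_le (vectorSpan ℝ (Set.range z))
          omega)
      obtain ⟨e⟩ := Function.Embedding.nonempty_of_card_le hcard
      -- Unused indices are padded with weight `0` and the arbitrary point `e₀` of `D`.
      refine ⟨(fun j => if h : ∃ i, e i = j then w h.choose else 0,
        fun j => if h : ∃ i, e i = j then z h.choose else e₀), ⟨⟨?_, ?_⟩, ?_⟩, ?_⟩
      · intro j
        dsimp only
        split_ifs with h
        · exact (hw _).le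
        · exact le_rfl
      · rw [← hw1]
        symm
        refine Finset.sum_of_injOn e e.injective.injOn (by simp) ?_ ?_
        · intro j _ hj
          have h : ¬ ∃ i, e i = j := by simpa using hj
          simp only [dif_neg h]
        · intro i _
          have h : ∃ i', e i' = e i := ⟨i, rfl⟩
          simp only [dif_pos h, e.injective h.choose_spec]
      · intro j _
        dsimp only
        split_ifs with h
        · exact hz ⟨_, rfl⟩
        · exact he₀
      · symm
        refine Finset.sum_of_injOn e e.injective.injOn (by simp) ?_ ?_
        · intro j _ hj
          have h : ¬ ∃ i, e i = j := by simpa using hj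
          simp only [dif_neg h, zero_smul]
        · intro i _
          have h : ∃ i', e i' = e i := ⟨i, rfl⟩
          simp only [dif_pos h, e.injective h.choose_spec]
    · rintro _ ⟨⟨w, z⟩, ⟨⟨hw0, hw1⟩, hz⟩, rfl⟩
      exact (convex_convexHull ℝ D).sum_mem (fun i _ => hw0 i) hw1
        fun i _ => subset_convexHull ℝ D (hz i (mem_univ i))
  rw [heq]
  exact hK.image hΦ

/-! ### Total variation and finitely supported measures -/

section Measures

variable {d : ℕ}

lemma sum_meas_apply {ι : Type*} (F : Finset ι) (w : ι → Meas d) (s : Set (Space d)) :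
    (∑ i ∈ F, w i) s = ∑ i ∈ F, w i s := by
  classical
  induction F using Finset.induction_on with
  | empty => simp
  | insert i F hi ih => rw [Finset.sum_insert hi, Finset.sum_insert hi, _root_.add_apply, ih]

lemma normM_eq (w : Meas d) : normM w = w.variation.real univ := by
  rw [normM, SignedMeasure.totalVariation_eq_variation]

lemma variation_real_add_le (w₁ w₂ : Meas d) (s : Set (Space d)) :
    (w₁ + w₂).variation.real s ≤ w₁.variation.real s + w₂.variation.real s := by
  rw [← measureReal_add_apply]
  exact ENNReal.toReal_mono (measure_ne_top _ _) (VectorMeasure.variation_add_le s)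

lemma variation_real_smul (c : ℝ) (w : Meas d) (s : Set (Space d)) :
    (c • w).variation.real s = |c| * w.variation.real s := by
  rw [VectorMeasure.variation_smul]
  simp [measureReal_def]

lemma normM_add_le (w₁ w₂ : Meas d) : normM (w₁ + w₂) ≤ normM w₁ + normM w₂ := by
  simpa only [normM_eq] using variation_real_add_le w₁ w₂ univ

lemma normM_smul (c : ℝ) (w : Meas d) : normM (c • w) = |c| * normM w := by
  simpa only [normM_eq] using variation_real_smul c w univ

lemma normM_nonneg (w : Meas d) : 0 ≤ normM w := measureReal_nonneg

lemma normM_zero : normM (0 : Meas d) = 0 := by simp [normM_eq]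

lemma normM_sum_le {ι : Type*} (F : Finset ι) (w : ι → Meas d) :
    normM (∑ i ∈ F, w i) ≤ ∑ i ∈ F, normM (w i) :=
  Finset.le_sum_of_subadditive _ normM_zero.le normM_add_le F w

lemma normM_eq_zero {w : Meas d} (h : normM w = 0) : w = 0 := by
  rw [normM_eq, measureReal_eq_zero_iff] at h
  exact VectorMeasure.variation_eq_zero.1 (Measure.measure_univ_eq_zero.1 h)

lemma normM_diracM (x : Space d) : normM (diracM x) = 1 := by
  rw [normM_eq, diracM, VectorMeasure.variation_dirac]
  simp [measureReal_def]

lemma normM_restrict (w : Meas d) {A : Set (Space d)} (hA : MeasurableSet A) :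
    normM (w.restrict A) = w.variation.real A := by
  rw [normM_eq, VectorMeasure.variation_restrict hA, measureReal_restrict_apply_univ]

lemma normM_sum_diracM_le (F : Finset (Space d)) (a : Space d → ℝ) :
    normM (∑ x ∈ F, a x • diracM x) ≤ ∑ x ∈ F, |a x| := by
  refine (normM_sum_le F _).trans (Finset.sum_le_sum fun x _ => ?_)
  rw [normM_smul, normM_diracM, mul_one]

lemma apply_eq_zero_of_variation (w : Meas d) {s : Set (Space d)} (h : w.variation s = 0) :
    w s = 0 := by
  have := w.enorm_measure_le_variation s
  rw [h] at this
  simpa using this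

/-- A measure concentrated on a finite set is a combination of Dirac impulses. -/
lemma eq_sum_diracM (w : Meas d) (F : Finset (Space d)) (h : w.variation (F : Set (Space d))ᶜ = 0) :
    w = ∑ x ∈ F, w {x} • diracM x := by
  classical
  have hF : MeasurableSet (F : Set (Space d)) := F.measurableSet
  ext s hs
  have h1 : w s = w (s ∩ F) := by
    have := VectorMeasure.of_union (v := w) (A := s ∩ F) (B := s \ F)
      (disjoint_sdiff_right.mono_left inter_subset_right)
      (hs.inter hF) (hs.diff hF)
    rw [inter_union_sdiff] at this
    rw [this, apply_eq_zero_of_variation (s := s \ F) w (measure_mono_null (fun x hx => hx.2) h),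
      add_zero]
  have h2 : s ∩ F = ⋃ x ∈ F.filter (· ∈ s), {x} := by
    ext x
    simp [and_comm]
  rw [h1, h2, VectorMeasure.of_biUnion_finset, Finset.sum_filter]
  · rw [sum_meas_apply]
    refine Finset.sum_congr rfl fun x _ => ?_
    by_cases hx : x ∈ s <;> simp [diracM, hx, hs]
  · intro x _ y _ hxy
    simpa using hxy
  · intro x _
    exact measurableSet_singleton x

/-- The norm of a measure concentrated on a finite set. -/
lemma normM_eq_sum_abs (w : Meas d) (F : Finset (Space d))
    (h : w.variation (F : Set (Space d))ᶜ = 0) : normM w = ∑ x ∈ F, |w {x}| := by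
  apply le_antisymm
  · conv_lhs => rw [eq_sum_diracM w F h]
    exact normM_sum_diracM_le F _
  · calc ∑ x ∈ F, |w {x}| ≤ ∑ x ∈ F, w.variation.real {x} :=
          Finset.sum_le_sum fun x _ => w.norm_measure_le_variation
      _ = w.variation.real F := by rw [sum_measureReal_singleton]
      _ ≤ normM w := by
        rw [normM_eq]
        exact measureReal_mono (subset_univ _)

lemma variation_sum_diracM_compl (F : Finset (Space d)) (a : Space d → ℝ) :
    (∑ x ∈ F, a x • diracM x).variation (F : Set (Space d))ᶜ = 0 := by
  have h := VectorMeasure.variation_finsetSum_le F (fun x => a x • (diracM x : Meas d))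
    (F : Set (Space d))ᶜ
  refine le_antisymm (h.trans ?_) bot_le
  rw [Measure.finsetSum_apply]
  refine (Finset.sum_eq_zero fun x hx => ?_).le
  rw [VectorMeasure.variation_smul, diracM, VectorMeasure.variation_dirac]
  simp [hx]

lemma integral_diracM (f : Space d → ℝ) (x : Space d) : ∫ᵛ t, f t ∂<•(diracM x) = f x := by
  simp [diracM]

/-- Perturbing a measure by multiples of its restrictions to disjoint sets. -/
lemma normM_add_sum_restrict_le {ι : Type*} (w : Meas d) (F : Finset ι) (A : ι → Set (Space d))
    (hA : ∀ i ∈ F, MeasurableSet (A i)) (hd : PairwiseDisjoint (F : Set ι) A) (c : ι → ℝ)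
    (hc : ∀ i ∈ F, |c i| ≤ 1) :
    normM (w + ∑ i ∈ F, c i • w.restrict (A i)) ≤
      normM w + ∑ i ∈ F, c i * w.variation.real (A i) := by
  have hU : MeasurableSet (⋃ i ∈ F, A i) := F.measurableSet_biUnion hA
  have hres : w.restrict (⋃ i ∈ F, A i) = ∑ i ∈ F, w.restrict (A i) := by
    ext s hs
    rw [VectorMeasure.restrict_apply _ hU hs, sum_meas_apply, inter_iUnion₂,
      VectorMeasure.of_biUnion_finset]
    · exact Finset.sum_congr rfl fun i hi => (VectorMeasure.restrict_apply _ (hA i hi) hs).symm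
    · exact hd.mono fun i => inter_subset_right
    · exact fun i hi => hs.inter (hA i hi)
  -- The perturbation only rescales `w` by `1 + c i` on `A i`. Since `1 + c i ≥ 0`, no absolute
  -- value remains and the bound is affine in `c`.
  have hw : w + ∑ i ∈ F, c i • w.restrict (A i) =
      w.restrict (⋃ i ∈ F, A i)ᶜ + ∑ i ∈ F, (1 + c i) • w.restrict (A i) := by
    simp only [add_smul, one_smul, Finset.sum_add_distrib]
    rw [← hres, ← add_assoc, add_comm (w.restrict _ᶜ),
      VectorMeasure.restrict_add_restrict_compl hU]
  have hn : normM w = w.variation.real (⋃ i ∈ F, A i)ᶜ + ∑ i ∈ F, w.variation.real (A i) := by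
    rw [normM_eq, ← measureReal_add_measureReal_compl hU, add_comm,
      measureReal_biUnion_finset hd hA]
  rw [hw, hn, add_assoc, ← Finset.sum_add_distrib]
  refine (normM_add_le _ _).trans (add_le_add (normM_restrict w hU.compl).le ?_)
  refine (normM_sum_le F _).trans (Finset.sum_le_sum fun i hi => ?_)
  have h1 := abs_le.1 (hc i hi)
  rw [normM_smul, normM_restrict w (hA i hi), abs_of_nonneg (by linarith)]
  linarith

end Measures

/-! ### Series of test functions and superpositions of translates -/

section TsumSchwartz

variable {ι V : Type*} [NormedAddCommGroup V] [NormedSpace ℝ V]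

lemma norm_pow_mul_iteratedFDeriv_tsum_le (s : ι → 𝓢(V, ℝ))
    (h : ∀ k n, Summable fun i => SchwartzMap.seminorm ℝ k n (s i)) (k n : ℕ) (x : V) :
    ‖x‖ ^ k * ‖iteratedFDeriv ℝ n (fun x => ∑' i, s i x) x‖ ≤
      ∑' i, SchwartzMap.seminorm ℝ k n (s i) := by
  rw [iteratedFDeriv_tsum_apply (N := ⊤) (v := fun n i => SchwartzMap.seminorm ℝ 0 n (s i))
    (fun i => (s i).smooth _) (fun n _ => h 0 n)
    (fun n i x _ => (s i).norm_iteratedFDeriv_le_seminorm ℝ n x) le_top]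
  have hs : Summable fun i => ‖iteratedFDeriv ℝ n (s i) x‖ :=
    (h 0 n).of_nonneg_of_le (fun _ => norm_nonneg _)
      fun i => (s i).norm_iteratedFDeriv_le_seminorm ℝ n x
  calc ‖x‖ ^ k * ‖∑' i, iteratedFDeriv ℝ n (s i) x‖
      ≤ ‖x‖ ^ k * ∑' i, ‖iteratedFDeriv ℝ n (s i) x‖ := by
        gcongr
        exact norm_tsum_le_tsum_norm hs
    _ = ∑' i, ‖x‖ ^ k * ‖iteratedFDeriv ℝ n (s i) x‖ := tsum_mul_left.symm
    _ ≤ _ := (hs.mul_left _).tsum_le_tsum (fun i => (s i).le_seminorm ℝ k n x) (h k n)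

/-- The sum of a family of test functions all of whose seminorms are summable. -/
def tsumSchwartz (s : ι → 𝓢(V, ℝ))
    (h : ∀ k n, Summable fun i => SchwartzMap.seminorm ℝ k n (s i)) : 𝓢(V, ℝ) where
  toFun x := ∑' i, s i x
  smooth' := contDiff_tsum (N := ⊤) (v := fun n i => SchwartzMap.seminorm ℝ 0 n (s i))
    (fun i => (s i).smooth _) (fun n _ => h 0 n)
    (fun n i x _ => (s i).norm_iteratedFDeriv_le_seminorm ℝ n x)
  decay' k n := ⟨_, norm_pow_mul_iteratedFDeriv_tsum_le s h k n⟩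

lemma seminorm_tsumSchwartz_le (s : ι → 𝓢(V, ℝ))
    (h : ∀ k n, Summable fun i => SchwartzMap.seminorm ℝ k n (s i)) (k n : ℕ) :
    SchwartzMap.seminorm ℝ k n (tsumSchwartz s h) ≤ ∑' i, SchwartzMap.seminorm ℝ k n (s i) :=
  SchwartzMap.seminorm_le_bound ℝ k n _ (tsum_nonneg fun _ => apply_nonneg _ _)
    (norm_pow_mul_iteratedFDeriv_tsum_le s h k n)

end TsumSchwartz

/-- Translations by bounded vectors are uniformly bounded in each Schwartz seminorm. -/
lemma exists_seminorm_translate_le {V : Type*} [NormedAddCommGroup V] [NormedSpace ℝ V]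
    (φ : 𝓢(V, ℝ)) (R : ℝ) (k n : ℕ) : ∃ C : ℝ, 0 ≤ C ∧ ∀ y ∈ Metric.closedBall (0 : V) R,
      SchwartzMap.seminorm ℝ k n (SchwartzMap.compSubConstCLM ℝ (-y) φ) ≤ C := by
  rcases lt_or_ge R 0 with hR | hR
  · exact ⟨0, le_rfl, by simp [Metric.closedBall_eq_empty.2 hR]⟩
  -- From `‖x‖ ≤ ‖x + y‖ + R` and `(a + b)^k ≤ 2^(k-1) (a^k + b^k)`.
  set C := 2 ^ (k - 1) * (SchwartzMap.seminorm ℝ k n φ + R ^ k * SchwartzMap.seminorm ℝ 0 n φ)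
  have hC : 0 ≤ C := by positivity
  refine ⟨C, hC, fun y hy => SchwartzMap.seminorm_le_bound ℝ k n _ hC fun x => ?_⟩
  have hy' : ‖y‖ ≤ R := by simpa using hy
  have hd : iteratedFDeriv ℝ n (SchwartzMap.compSubConstCLM ℝ (-y) φ) x =
      iteratedFDeriv ℝ n φ (x + y) := by
    rw [← iteratedFDeriv_comp_add_right]
    congr 1
    ext z
    simp
  have hx : ‖x‖ ≤ ‖x + y‖ + R := by
    have := norm_sub_le (x + y) y
    rw [add_sub_cancel_right] at this
    linarith
  rw [hd]
  calc ‖x‖ ^ k * ‖iteratedFDeriv ℝ n φ (x + y)‖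
      ≤ (‖x + y‖ + R) ^ k * ‖iteratedFDeriv ℝ n φ (x + y)‖ := by gcongr
    _ ≤ (2 ^ (k - 1) * (‖x + y‖ ^ k + R ^ k)) * ‖iteratedFDeriv ℝ n φ (x + y)‖ := by
        gcongr
        exact add_pow_le (norm_nonneg _) hR k
    _ = 2 ^ (k - 1) * (‖x + y‖ ^ k * ‖iteratedFDeriv ℝ n φ (x + y)‖ +
          R ^ k * ‖iteratedFDeriv ℝ n φ (x + y)‖) := by ring
    _ ≤ C := by
        have h₁ := φ.le_seminorm ℝ k n (x + y)
        have h₂ := φ.norm_iteratedFDeriv_le_seminorm ℝ n (x + y)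
        simp only [C]
        gcongr

section BallCoeff

variable {V : Type*} [NormedAddCommGroup V]

/-- Summable families of coefficients indexed by a ball. -/
abbrev BallCoeff (V : Type*) [NormedAddCommGroup V] (R : ℝ) : Type _ :=
  lp (fun _ : Metric.closedBall (0 : V) R => ℝ) 1

lemma BallCoeff.summable {R : ℝ} (e : BallCoeff V R) : Summable fun y => |e y| := by
  have := (memℓp_gen_iff (by simp)).1 e.2
  simpa using this

lemma BallCoeff.norm_eq {R : ℝ} (e : BallCoeff V R) : ‖e‖ = ∑' y, |e y| := by
  rw [lp.norm_eq_tsum_rpow (by simp)]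
  simp

end BallCoeff

section Translates

variable {V : Type*} [NormedAddCommGroup V] [NormedSpace ℝ V] (φ : 𝓢(V, ℝ)) (R : ℝ)

lemma summable_seminorm_translates (e : BallCoeff V R) (k n : ℕ) :
    Summable fun y => SchwartzMap.seminorm ℝ k n
      (e y • SchwartzMap.compSubConstCLM ℝ (-(y : V)) φ) := by
  obtain ⟨C, hC, h⟩ := exists_seminorm_translate_le φ R k n
  refine (e.summable.mul_right C).of_nonneg_of_le (fun _ => apply_nonneg _ _) fun y => ?_
  rw [map_smul_eq_mul, Real.norm_eq_abs]
  gcongr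
  exact h y y.2

/-- The superposition `∑ e_y φ(· + y)` of translates of a test function. -/
def translates : BallCoeff V R →ₗ[ℝ] 𝓢(V, ℝ) where
  toFun e := tsumSchwartz _ (summable_seminorm_translates φ R e)
  map_add' e e' := by
    have hs : ∀ (e : BallCoeff V R) (x : V), Summable fun y =>
        (e y • SchwartzMap.compSubConstCLM ℝ (-(y : V)) φ) x := fun e x =>
      (summable_seminorm_translates φ R e 0 0).of_norm_bounded
        fun y => SchwartzMap.norm_le_seminorm ℝ _ x
    ext x
    refine Eq.trans (tsum_congr fun y => ?_) ((hs e x).tsum_add (hs e' x))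
    simp [add_mul]
  map_smul' c e := by
    ext x
    refine Eq.trans (tsum_congr fun y => ?_) tsum_mul_left
    simp [mul_assoc]

/-- Unit coefficient vectors all have norm one, so a norm bound on the coefficient space becomes a
bound uniform over the translates. -/
lemma translates_single [DecidableEq (Metric.closedBall (0 : V) R)]
    (y : Metric.closedBall (0 : V) R) :
    translates φ R (lp.single 1 y 1) = SchwartzMap.compSubConstCLM ℝ (-(y : V)) φ := by
  ext x
  refine (tsum_eq_single y ?_).trans ?_
  · intro y' hy'
    simp [hy']
  · simp

lemma continuous_translates : Continuous (translates φ R) := by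
  refine WithSeminorms.continuous_of_isBounded (norm_withSeminorms ℝ (BallCoeff V R))
    (schwartz_withSeminorms ℝ V ℝ) _ ?_
  rintro ⟨k, n⟩
  obtain ⟨C, hC, h⟩ := exists_seminorm_translate_le φ R k n
  refine ⟨{0}, ⟨C, hC⟩, fun e => ?_⟩
  simp only [Finset.sup_singleton]
  change SchwartzMap.seminorm ℝ k n (tsumSchwartz _ (summable_seminorm_translates φ R e)) ≤ C * ‖e‖
  refine (seminorm_tsumSchwartz_le _ _ k n).trans ?_
  rw [e.norm_eq, ← tsum_mul_left]
  refine (summable_seminorm_translates φ R e k n).tsum_le_tsum (fun y => ?_)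
    (e.summable.mul_left C)
  rw [map_smul_eq_mul, Real.norm_eq_abs, mul_comm]
  gcongr
  exact h y y.2

end Translates

/-! ### The adjoint: translation, and continuity into local `L¹` -/

section Adjoint

variable {d : ℕ}

lemma IsAdjointAt.add {L : LSIOperator d} {φ₁ φ₂ : 𝓢(Space d, ℝ)} {g₁ g₂ : Space d → ℝ}
    (h₁ : IsAdjointAt L.toLin φ₁ g₁) (h₂ : IsAdjointAt L.toLin φ₂ g₂) :
    IsAdjointAt L.toLin (φ₁ + φ₂) (fun x => g₁ x + g₂ x) := by
  refine ⟨h₁.1.add h₂.1, fun ψ => ?_⟩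
  obtain ⟨i₁, e₁⟩ := h₁.2 ψ
  obtain ⟨i₂, e₂⟩ := h₂.2 ψ
  simp only [mul_add]
  exact ⟨i₁.add i₂, by rw [integral_add i₁ i₂, e₁, e₂, map_add]⟩

lemma IsAdjointAt.smul {L : LSIOperator d} {φ : 𝓢(Space d, ℝ)} {g : Space d → ℝ}
    (h : IsAdjointAt L.toLin φ g) (c : ℝ) : IsAdjointAt L.toLin (c • φ) (fun x => c * g x) := by
  refine ⟨h.1.smul c, fun ψ => ?_⟩
  obtain ⟨i, e⟩ := h.2 ψ
  simp only [mul_left_comm _ c]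
  exact ⟨i.const_mul c, by rw [integral_const_mul, e, map_smul, smul_eq_mul]⟩

lemma IsAdjointAt.translate {L : LSIOperator d} {φ : 𝓢(Space d, ℝ)} {g : Space d → ℝ}
    (h : IsAdjointAt L.toLin φ g) (a : Space d) :
    IsAdjointAt L.toLin (SchwartzMap.compSubConstCLM ℝ a φ) (fun x => g (x - a)) := by
  refine ⟨?_, fun ψ => ?_⟩
  · rw [locallyIntegrable_iff]
    intro K hK
    have hK' : IsCompact ((fun x => x - a) '' K) := hK.image (by fun_prop)
    have hm := measurePreserving_sub_right (volume : Measure (Space d)) a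
    have he : MeasurableEmbedding fun x : Space d => x - a :=
      (Homeomorph.subRight a).measurableEmbedding
    exact (hm.integrableOn_image he).1 (h.1.integrableOn_isCompact hK')
  · obtain ⟨i, e⟩ := h.2 (SchwartzMap.compSubConstCLM ℝ (-a) ψ)
    have hfun : (fun x => ψ x * g (x - a)) =
        fun x => (fun x => SchwartzMap.compSubConstCLM ℝ (-a) ψ x * g x) (x - a) := by
      ext x
      simp
    rw [hfun, integral_sub_right_eq_self
      (fun x => SchwartzMap.compSubConstCLM ℝ (-a) ψ x * g x) a, e, L.shift, neg_neg]
    exact ⟨i.comp_sub_right a, rfl⟩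

lemma HasImage.translate {L : LSIOperator d} {ρ : Space d → ℝ} (h : HasImage L ρ (diracM 0))
    (a : Space d) : HasImage L (fun x => ρ (x - a)) (diracM a) := by
  intro φ
  obtain ⟨g, ha, i, e⟩ := h (SchwartzMap.compSubConstCLM ℝ (-a) φ)
  refine ⟨fun x => g (x - a), ?_, i.comp_sub_right a, ?_⟩
  · have := ha.translate a
    rwa [SchwartzMap.compSubConstCLM_comp, neg_add_cancel, SchwartzMap.compSubConstCLM_zero] at this
  · rw [integral_sub_right_eq_self (fun x => ρ x * g x) a, e, integral_diracM, integral_diracM]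
    simp

/-- The image of a function, tested with an arbitrary representative of the adjoint. -/
lemma HasImage.integral_eq {L : LSIOperator d} {f : Space d → ℝ} {w : Meas d}
    (h : HasImage L f w) {φ : 𝓢(Space d, ℝ)} {g : Space d → ℝ} (hg : IsAdjointAt L.toLin φ g) :
    Integrable (fun x => f x * g x) ∧ ∫ x, f x * g x = ∫ᵛ x, φ x ∂<•w := by
  obtain ⟨g', ha, i, e⟩ := h φ
  have hae : (fun x => f x * g' x) =ᵐ[volume] fun x => f x * g x := by
    filter_upwards [ha.ae_eq hg] with x hx
    rw [hx]
  exact ⟨i.congr hae, (integral_congr_ae hae).symm.trans e⟩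

/-- Along a continuous linear family of test functions indexed by a Banach space, the adjoint is
continuous with values in the locally integrable functions. -/
lemma exists_setIntegral_adjoint_le (L : LSIOperator d) {E : Type*} [NormedAddCommGroup E]
    [NormedSpace ℝ E] [CompleteSpace E] (T : E →ₗ[ℝ] 𝓢(Space d, ℝ)) (hT : Continuous T) (r : ℝ) :
    ∃ C : ℝ, 0 ≤ C ∧ ∀ (e : E) (g : Space d → ℝ), IsAdjointAt L.toLin (T e) g →
      ∫ x in Metric.ball 0 r, |g x| ≤ C * ‖e‖ := by
  set U := Metric.ball (0 : Space d) r
  choose G hG using fun e => L.adjoint (T e)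
  have hint : ∀ e, Integrable (G e) (volume.restrict U) := fun e =>
    ((hG e).1.integrableOn_isCompact (isCompact_closedBall 0 r)).mono_set
      Metric.ball_subset_closedBall
  let W : E →ₗ[ℝ] Lp ℝ 1 (volume.restrict U) :=
    { toFun := fun e => (hint e).toL1 _
      map_add' := fun e e' => by
        rw [← Integrable.toL1_add]
        refine (Integrable.toL1_eq_toL1_iff _ _ _ _).2 (ae_restrict_of_ae ?_)
        have h := hG (e + e')
        rw [map_add] at h
        exact h.ae_eq ((hG e).add (hG e'))
      map_smul' := fun c e => by
        rw [RingHom.id_apply, ← Integrable.toL1_smul]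
        refine (Integrable.toL1_eq_toL1_iff _ _ _ _).2 (ae_restrict_of_ae ?_)
        have h := hG (c • e)
        rw [map_smul] at h
        exact h.ae_eq ((hG e).smul c) }
  have hW : ∀ e, W e =ᵐ[volume.restrict U] G e := fun e => Integrable.coeFn_toL1 (hint e)
  have hcont : Continuous W := by
    -- Closed graph theorem. A limit in `L¹(U)` is identified by testing with `ψ` supported in `U`:
    -- the pairing of `ψ` with `G e` is `⟨Lψ, T e⟩`, continuous in `e` because `Lψ` is a tempered
    -- distribution. Continuity of `L` itself is not needed.
    refine W.continuous_of_seq_closed_graph fun u x y hu hy => ?_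
    refine Lp.ext (Filter.EventuallyEq.trans ?_ (hW x).symm)
    have hyi : Integrable y (volume.restrict U) := L1.integrable_coeFn y
    have hz : ∀ᵐ t ∂volume, t ∈ U → y t - G x t = 0 := by
      refine Metric.isOpen_ball.ae_eq_zero_of_integral_contDiff_smul_eq_zero
        (IntegrableOn.locallyIntegrableOn (hyi.sub (hint x))) fun ψ hψ hψc hψU => ?_
      set ψ' := hψc.toSchwartzMap hψ
      have hoff : ∀ (f : Space d → ℝ), ∫ t, ψ t • f t = ∫ t in U, ψ t • f t := fun f =>
        (setIntegral_eq_integral_of_forall_compl_eq_zero fun t ht => by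
          rw [image_eq_zero_of_notMem_tsupport fun h => ht (hψU h), zero_smul]).symm
      obtain ⟨c, hc⟩ := hψc.exists_bound_of_continuous hψ.continuous
      have hmul : ∀ {f : Space d → ℝ}, Integrable f (volume.restrict U) →
          Integrable (fun t => ψ t • f t) (volume.restrict U) :=
        fun hf => hf.bdd_mul hψ.continuous.aestronglyMeasurable (Eventually.of_forall hc)
      have hadj : ∀ e, ∫ t in U, ψ t • G e t = L.toLin ψ' (T e) := fun e => by
        rw [← hoff]
        exact ((hG e).2 ψ').2
      have hlim₁ : Tendsto (fun k => ∫ t in U, ψ t • G (u k) t) atTop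
          (𝓝 (∫ t in U, ψ t • G x t)) := by
        simp only [hadj]
        exact (((L.toLin ψ').continuous.comp hT).tendsto x).comp hu
      have hlim₂ : Tendsto (fun k => ∫ t in U, ψ t • G (u k) t) atTop
          (𝓝 (∫ t in U, ψ t • y t)) := by
        rw [tendsto_iff_norm_sub_tendsto_zero]
        have h0 : Tendsto (fun k => c * ‖W (u k) - y‖) atTop (𝓝 0) := by
          have := (tendsto_iff_norm_sub_tendsto_zero.1 hy).const_mul c
          simpa using this
        refine squeeze_zero (fun _ => norm_nonneg _) (fun k => ?_) h0
        rw [← integral_sub (hmul (hint _)) (hmul hyi), L1.norm_eq_integral_norm,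
          ← integral_const_mul]
        refine norm_integral_le_of_norm_le ((L1.integrable_coeFn _).norm.const_mul c) ?_
        filter_upwards [hW (u k), Lp.coeFn_sub (W (u k)) y] with t h1 h2
        rw [h2, Pi.sub_apply, h1, ← smul_sub, norm_smul]
        gcongr
        exact hc t
      have := tendsto_nhds_unique hlim₁ hlim₂
      rw [hoff]
      simp only [smul_sub]
      rw [integral_sub (hmul hyi) (hmul (hint x)), this, sub_self]
    rw [Filter.EventuallyEq, ae_restrict_iff' measurableSet_ball]
    filter_upwards [hz] with t ht htU
    exact sub_eq_zero.1 (ht htU)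
  refine ⟨‖(⟨W, hcont⟩ : E →L[ℝ] _)‖, norm_nonneg _, fun e g hg => ?_⟩
  have h := (⟨W, hcont⟩ : E →L[ℝ] Lp ℝ 1 (volume.restrict U)).le_opNorm e
  refine le_trans (le_of_eq ?_) h
  change _ = ‖W e‖
  rw [L1.norm_eq_integral_norm]
  refine integral_congr_ae ?_
  filter_upwards [hW e, ae_restrict_of_ae ((hG e).ae_eq hg)] with t h1 h2
  rw [h1, h2, Real.norm_eq_abs]

end Adjoint

/-! ### Lifting measures of bounded support through convolution with the Green's function -/

section Lift

variable {d : ℕ}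

/-- A Green's function of polynomial growth pairs with all bounded translates of the adjoint of a
test function, with a uniform bound. -/
lemma exists_integral_translate_le {L : LSIOperator d} {ρ : Space d → ℝ}
    (hρ : HasImage L ρ (diracM 0)) {c : ℝ} (hc : 0 ≤ c) {n : ℕ}
    (hb : ∀ x, |ρ x| ≤ c * (1 + ‖x‖) ^ n) {φ : 𝓢(Space d, ℝ)} {g : Space d → ℝ}
    (hg : IsAdjointAt L.toLin φ g) (R : ℝ) :
    ∃ C : ℝ, ∀ y ∈ Metric.closedBall (0 : Space d) R, ∫ x, |ρ (x - y) * g x| ≤ C := by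
  classical
  choose G hG using fun e => L.adjoint (translates φ R e)
  have hint : ∀ e, Integrable (fun x => |ρ x * G e x|) := fun e => (hρ.integral_eq (hG e)).1.abs
  -- Truncation to balls makes each seminorm continuous, since `ρ` is bounded on a ball and the
  -- adjoint is continuous into `L¹` of the ball.
  let P : ℕ → Seminorm ℝ (BallCoeff (Space d) R) := fun r => Seminorm.of
    (fun e => ∫ x in Metric.ball 0 r, |ρ x * G e x|)
    (fun e e' => by
      rw [← integral_add (hint e).integrableOn (hint e').integrableOn]
      refine integral_mono_ae (hint _).integrableOn
        ((hint e).integrableOn.add (hint e').integrableOn) (ae_restrict_of_ae ?_)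
      have h := hG (e + e')
      rw [map_add] at h
      filter_upwards [h.ae_eq ((hG e).add (hG e'))] with x hx
      rw [hx, mul_add]
      exact abs_add_le _ _)
    (fun a e => by
      rw [← integral_const_mul]
      refine integral_congr_ae (ae_restrict_of_ae ?_)
      have h := hG (a • e)
      rw [map_smul] at h
      filter_upwards [h.ae_eq ((hG e).smul a)] with x hx
      rw [hx, mul_left_comm, abs_mul, Real.norm_eq_abs])
  have hP : ∀ r e, P r e = ∫ x in Metric.ball 0 r, |ρ x * G e x| := fun r e => rfl
  have hPc : ∀ r, Continuous (P r) := by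
    intro r
    obtain ⟨C, hC, h⟩ := exists_setIntegral_adjoint_le L (translates φ R)
      (continuous_translates φ R) r
    have hCr : 0 ≤ c * (1 + r) ^ n * C := by positivity
    let K : NNReal := ⟨c * (1 + r) ^ n * C, hCr⟩
    refine Seminorm.continuous_of_le (q := K • normSeminorm ℝ (BallCoeff (Space d) R)) ?_
      fun e => ?_
    · exact (continuous_norm (E := BallCoeff (Space d) R)).const_smul K
    · change P r e ≤ c * (1 + r) ^ n * C * ‖e‖
      rw [hP, mul_assoc]
      have hGi : IntegrableOn (G e) (Metric.ball 0 r) :=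
        ((hG e).1.integrableOn_isCompact (isCompact_closedBall 0 r)).mono_set
          Metric.ball_subset_closedBall
      refine le_trans ?_ (mul_le_mul_of_nonneg_left (h e (G e) (hG e)) (by positivity))
      rw [← integral_const_mul]
      refine setIntegral_mono_on (hint e).integrableOn (hGi.abs.const_mul _) measurableSet_ball
        fun x hx => ?_
      rw [abs_mul]
      have hx' : ‖x‖ ≤ r := (mem_ball_zero_iff.1 hx).le
      gcongr
      exact (hb x).trans (by gcongr)
  -- Pointwise boundedness holds because `ρ · L*ψ` is integrable for every test function `ψ`, in
  -- particular for every superposition. On a Banach space the supremum is then a continuous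
  -- seminorm.
  have hPb : BddAbove (range P) := by
    rw [Seminorm.bddAbove_range_iff]
    rintro e
    refine ⟨∫ x, |ρ x * G e x|, ?_⟩
    rintro _ ⟨r, rfl⟩
    exact setIntegral_le_integral (hint e) (Eventually.of_forall fun x => abs_nonneg _)
  obtain ⟨C, -, hC⟩ := Seminorm.bound_of_continuous_normedSpace (⨆ r, P r) (by
    have := Seminorm.continuous_iSup P hPc hPb
    rwa [← Seminorm.coe_iSup_eq hPb] at this)
  refine ⟨C, fun y hy => ?_⟩
  set e : BallCoeff (Space d) R := lp.single 1 ⟨y, hy⟩ 1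
  have he : ‖e‖ = 1 := by simp [e, lp.norm_single]
  have hbound : ∀ r : ℕ, ∫ x in Metric.ball 0 r, |ρ x * G e x| ≤ C := by
    intro r
    have h1 := hC e
    rw [he, mul_one] at h1
    exact (le_trans (le_ciSup hPb r e) h1)
  have hlim : Tendsto (fun r : ℕ => ∫ x in Metric.ball (0 : Space d) r, |ρ x * G e x|) atTop
      (𝓝 (∫ x in ⋃ r : ℕ, Metric.ball (0 : Space d) r, |ρ x * G e x|)) :=
    tendsto_setIntegral_of_monotone (fun _ => measurableSet_ball)
      (fun a b hab => Metric.ball_subset_ball (by exact_mod_cast hab)) (hint e).integrableOn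
  rw [Metric.iUnion_ball_nat, setIntegral_univ] at hlim
  have hle := le_of_tendsto' hlim hbound
  have hadj : IsAdjointAt L.toLin (translates φ R e) (fun x => g (x + y)) := by
    have := hg.translate (-y)
    simp only [sub_neg_eq_add] at this
    rwa [translates_single]
  -- Substituting `x + y` for `x` moves the translation from `ρ` to `g`.
  rw [← integral_add_right_eq_self _ y]
  refine le_trans (le_of_eq (integral_congr_ae ?_)) hle
  filter_upwards [hadj.ae_eq (hG e)] with x hx
  rw [← hx, add_sub_cancel_right]

/-- A function of polynomial growth has a measurable representative with an everywhere bound. -/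
lemma MemWeighted.exists_measurable {n : ℕ} {f : Space d → ℝ} (h : MemWeighted n f) :
    ∃ f' : Space d → ℝ, Measurable f' ∧ f =ᵐ[volume] f' ∧
      ∃ C : ℝ, 0 ≤ C ∧ ∀ x, |f' x| ≤ C * (1 + ‖x‖) ^ n := by
  obtain ⟨hm, C, hC⟩ := h
  set S := {x | |hm.mk f x| ≤ C * (1 + ‖x‖) ^ n}
  have hmk : Measurable (hm.mk f) := hm.stronglyMeasurable_mk.measurable
  have hS : MeasurableSet S := measurableSet_le (by fun_prop) (by fun_prop)
  refine ⟨S.indicator (hm.mk f), hmk.indicator hS, ?_, |C|, abs_nonneg C, fun x => ?_⟩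
  · filter_upwards [hm.ae_eq_mk, hC] with x hx hCx
    rw [hx] at hCx ⊢
    rw [indicator_of_mem (by exact hCx)]
  · by_cases hx : x ∈ S
    · rw [indicator_of_mem hx]
      exact (show |hm.mk f x| ≤ _ from hx).trans (by gcongr; exact le_abs_self C)
    · rw [indicator_of_notMem hx, abs_zero]
      positivity

/-- A positive measure of bounded support is the image of a function of polynomial growth, its
convolution with the Green's function. -/
lemma exists_hasImage_toSignedMeasure {L : LSIOperator d} {ρ : Space d → ℝ} {n : ℕ}
    (hw : MemWeighted n ρ) (hρ : HasImage L ρ (diracM 0)) (μ : Measure (Space d))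
    [IsFiniteMeasure μ] {R : ℝ} (hμ : ∀ᵐ y ∂μ, y ∈ Metric.closedBall (0 : Space d) R) :
    ∃ f, MemWeighted n f ∧ HasImage L f μ.toSignedMeasure := by
  obtain ⟨ρ', hm, hae, c, hc, hb⟩ := hw.exists_measurable
  replace hρ := hρ.congr hae
  have hmeas : Measurable fun q : Space d × Space d => ρ' (q.1 - q.2) :=
    hm.comp (measurable_fst.sub measurable_snd)
  -- The constant comes from `1 + ‖x - y‖ ≤ (1 + R) (1 + ‖x‖)` for `‖y‖ ≤ R`.
  refine ⟨fun x => ∫ y, ρ' (x - y) ∂μ, ⟨?_, c * (1 + R) ^ n * μ.real univ, ?_⟩, fun φ => ?_⟩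
  · exact (StronglyMeasurable.integral_prod_right hmeas.stronglyMeasurable).aestronglyMeasurable
  · refine Eventually.of_forall fun x => ?_
    have h : ∀ᵐ y ∂μ, ‖ρ' (x - y)‖ ≤ c * ((1 + R) ^ n * (1 + ‖x‖) ^ n) := by
      filter_upwards [hμ] with y hy
      refine (hb _).trans ?_
      have hy' : ‖y‖ ≤ R := by simpa using hy
      rw [← mul_pow]
      gcongr
      have := norm_sub_le x y
      nlinarith [norm_nonneg x, norm_nonneg y]
    refine (norm_integral_le_of_norm_le_const h).trans (le_of_eq ?_)
    ring
  · obtain ⟨g, hg⟩ := L.adjoint φ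
    obtain ⟨C, hC⟩ := exists_integral_translate_le hρ hc hb hg R
    have hF : AEStronglyMeasurable (fun q : Space d × Space d => ρ' (q.1 - q.2) * g q.1)
        (volume.prod μ) :=
      hmeas.aestronglyMeasurable.mul hg.1.aestronglyMeasurable.comp_fst
    have hsec : ∀ y, Integrable (fun x => ρ' (x - y) * g x) ∧
        ∫ x, ρ' (x - y) * g x = φ y := fun y => by
      have := (hρ.translate y).integral_eq hg
      rwa [integral_diracM] at this
    have hFi : Integrable (fun q : Space d × Space d => ρ' (q.1 - q.2) * g q.1)
        (volume.prod μ) := by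
      rw [integrable_prod_iff' hF]
      refine ⟨Eventually.of_forall fun y => (hsec y).1, ?_⟩
      -- The uniform bound `C` over the ball, with `μ` finite, gives joint integrability.
      refine Integrable.of_bound hF.norm.prod_swap.integral_prod_right' C ?_
      filter_upwards [hμ] with y hy
      rw [Real.norm_of_nonneg (integral_nonneg fun _ => norm_nonneg _)]
      exact hC y hy
    refine ⟨g, hg, ?_, ?_⟩
    · have := hFi.integral_prod_left
      simpa only [integral_mul_const] using this
    · simp only [← integral_mul_const]
      rw [integral_integral_swap hFi, VectorMeasure.integral_toSignedMeasure]
      exact integral_congr_ae (Eventually.of_forall fun y => (hsec y).2)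

lemma exists_mem_nativeSpace {L : LSIOperator d} {n : ℕ} {f : Space d → ℝ} {w : Meas d}
    (hf : MemWeighted n f) (hw : HasImage L f w) :
    ∃ F : nativeSpace L n, (F : Space d →ₘ[volume] ℝ) =ᵐ[volume] f ∧ opL L n F = w := by
  have hae := AEEqFun.coeFn_mk f hf.1
  refine ⟨⟨AEEqFun.mk f hf.1, hf.congr hae.symm, w, hw.congr hae.symm⟩, hae, ?_⟩
  exact (hasImage_opL L n _).unique (hw.congr hae.symm)

lemma IsSplineAdmissible.memWeighted {L : LSIOperator d} {ρ : Space d → ℝ}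
    (h : IsSplineAdmissible L ρ) : MemWeighted (growthOrder ρ) ρ :=
  Nat.sInf_mem (s := {n : ℕ | MemWeighted n ρ}) h.slow_growth

/-- Every Dirac impulse is the image of a translate of the Green's function. -/
lemma IsSplineAdmissible.exists_opL_eq_diracM {L : LSIOperator d} {ρ : Space d → ℝ}
    (h : IsSplineAdmissible L ρ) (x : Space d) : ∃ F : nativeSpace L (growthOrder ρ),
      (F : Space d →ₘ[volume] ℝ) =ᵐ[volume] (fun t => ρ (t - x)) ∧
        opL L (growthOrder ρ) F = diracM x := by
  refine exists_mem_nativeSpace ⟨?_, ?_⟩ (h.green.translate x)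
  · exact h.memWeighted.1.comp_quasiMeasurePreserving
      (measurePreserving_sub_right volume x).quasiMeasurePreserving
  · obtain ⟨-, C, hC⟩ := h.memWeighted
    refine ⟨|C| * (1 + ‖x‖) ^ growthOrder ρ, ?_⟩
    filter_upwards [(measurePreserving_sub_right volume x).quasiMeasurePreserving.ae hC] with t ht
    rw [mul_assoc, ← mul_pow]
    refine ht.trans ((mul_le_mul_of_nonneg_right (le_abs_self C) (by positivity)).trans ?_)
    gcongr
    have := norm_sub_le t x
    nlinarith [norm_nonneg x, norm_nonneg t]

/-- The restriction of a finite measure to a bounded set is in the range of the operator. -/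
lemma IsSplineAdmissible.exists_opL_eq_restrict {L : LSIOperator d} {ρ : Space d → ℝ}
    (h : IsSplineAdmissible L ρ) (w : Meas d) {A : Set (Space d)} (hA : MeasurableSet A)
    {R : ℝ} (hR : A ⊆ Metric.closedBall 0 R) : ∃ F : nativeSpace L (growthOrder ρ),
      opL L (growthOrder ρ) F = w.restrict A := by
  have key : ∀ μ : Measure (Space d), ∀ _ : IsFiniteMeasure μ,
      ∃ F : nativeSpace L (growthOrder ρ),
        opL L (growthOrder ρ) F = (μ.restrict A).toSignedMeasure := by
    intro μ _
    obtain ⟨f, hf, hi⟩ := exists_hasImage_toSignedMeasure h.memWeighted h.green (μ.restrict A)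
      (R := R) ((ae_restrict_mem hA).mono fun y hy => hR hy)
    obtain ⟨F, -, hF⟩ := exists_mem_nativeSpace hf hi
    exact ⟨F, hF⟩
  obtain ⟨F₁, h₁⟩ := key w.toJordanDecomposition.posPart inferInstance
  obtain ⟨F₂, h₂⟩ := key w.toJordanDecomposition.negPart inferInstance
  refine ⟨F₁ - F₂, ?_⟩
  rw [map_sub, h₁, h₂]
  conv_rhs => rw [← w.toSignedMeasure_toJordanDecomposition, JordanDecomposition.toSignedMeasure]
  rw [VectorMeasure.restrict_sub, VectorMeasure.restrict_toSignedMeasure hA,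
    VectorMeasure.restrict_toSignedMeasure hA]

end Lift

/-! ### Minimal-norm measures under finitely many moment constraints -/

section Moments

variable {d M : ℕ}

/-- The generalized moments `∫ u_i dw` of a measure. -/
def moments (u : Fin M → C₀(Space d, ℝ)) : Meas d →ₗ[ℝ] (Fin M → ℝ) where
  toFun w i := ∫ᵛ x, u i x ∂<•w
  map_add' w₁ w₂ := by
    ext i
    exact VectorMeasure.integral_add_vectorMeasure (integrable_zeroAtInfty _ (u i))
      (integrable_zeroAtInfty _ (u i))
  map_smul' c w := by
    ext i
    exact VectorMeasure.integral_smul_vectorMeasure _ c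

/-- Moves a separating functional under the integral, where it only sees the moments of Dirac
impulses. -/
lemma dual_moments (u : Fin M → C₀(Space d, ℝ)) (ℓ : (Fin M → ℝ) →ₗ[ℝ] ℝ) (w : Meas d) :
    ℓ (moments u w) = ∫ᵛ x, ℓ (fun i => u i x) ∂<•w := by
  have hi : ∀ i ∈ Finset.univ, w.Integrable fun x => ℓ (Pi.single i 1) • u i x := fun i _ =>
    MeasureTheory.Integrable.const_mul (integrable_zeroAtInfty w (u i)) _
  have h : ∀ v : Fin M → ℝ, ℓ v = ∑ i, ℓ (Pi.single i 1) • v i := fun v => by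
    conv_lhs => rw [ℓ.pi_apply_eq_sum_univ v]
    refine Finset.sum_congr rfl fun i _ => ?_
    have hi : (Pi.single i 1 : Fin M → ℝ) = fun j => if i = j then 1 else 0 := by
      ext j
      simp [Pi.single_apply, eq_comm]
    rw [hi, smul_eq_mul, smul_eq_mul, mul_comm]
  have hfun : (fun x => ℓ fun i => u i x) = fun x => ∑ i, ℓ (Pi.single i 1) • u i x :=
    funext fun x => h _
  rw [h (moments u w), hfun, VectorMeasure.integral_finsetSum _ hi]
  refine Finset.sum_congr rfl fun i _ => ?_
  exact (VectorMeasure.integral_fun_smul w (ContinuousLinearMap.lsmul ℝ ℝ).flip _ (u i)).symm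

lemma moments_diracM (u : Fin M → C₀(Space d, ℝ)) (x : Space d) :
    moments u (diracM x) = fun i => u i x := by
  ext i
  exact integral_diracM _ x

/-- The symmetrized closure of the image of the Dirac impulses under `T ∘ moments u`. -/
def atomSet (u : Fin M → C₀(Space d, ℝ)) (T : (Fin M → ℝ) →ₗ[ℝ] (Fin M → ℝ)) :
    Set (Fin M → ℝ) :=
  insert 0 (range fun x => T fun i => u i x) ∪ -insert 0 (range fun x => T fun i => u i x)

lemma isCompact_atomSet (u : Fin M → C₀(Space d, ℝ)) (T : (Fin M → ℝ) →ₗ[ℝ] (Fin M → ℝ)) :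
    IsCompact (atomSet u T) := by
  have hT : Continuous T := T.continuous_of_finiteDimensional
  -- The inserted `0` is the limit at infinity of the moments of `δ_x`.
  have h : IsCompact (insert 0 (range fun x => T fun i => u i x)) := by
    refine Filter.Tendsto.isCompact_insert_range_of_cocompact ?_ (by fun_prop)
    have h0 : Tendsto (fun x => fun i => u i x) (cocompact (Space d)) (𝓝 (0 : Fin M → ℝ)) :=
      tendsto_pi_nhds.2 fun i => (u i).zero_at_infty'
    have := (hT.tendsto 0).comp h0
    rwa [map_zero] at this
  exact h.union h.neg

lemma isCompact_convexHull_atomSet (u : Fin M → C₀(Space d, ℝ))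
    (T : (Fin M → ℝ) →ₗ[ℝ] (Fin M → ℝ)) : IsCompact (convexHull ℝ (atomSet u T)) :=
  isCompact_convexHull (isCompact_atomSet u T)

/-- Moments of measures belong to the dilated convex hull of the moments of Dirac impulses. -/
lemma moments_mem_smul_convexHull (u : Fin M → C₀(Space d, ℝ))
    (T : (Fin M → ℝ) →ₗ[ℝ] (Fin M → ℝ)) (w : Meas d) :
    T (moments u w) ∈ normM w • convexHull ℝ (atomSet u T) := by
  rcases (normM_nonneg w).eq_or_lt with h0 | hpos
  · rw [normM_eq_zero h0.symm, map_zero, map_zero]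
    exact ⟨0, subset_convexHull ℝ _ (Or.inl (mem_insert _ _)), smul_zero _⟩
  by_contra hnot
  have hK := isCompact_convexHull_atomSet u T
  obtain ⟨f, s, hs, hfs⟩ := geometric_hahn_banach_closed_point
    ((convex_convexHull ℝ (atomSet u T)).smul (normM w)) (hK.smul (normM w)).isClosed hnot
  -- Symmetry of the atoms turns the one-sided separation into a bound on the absolute value;
  -- integrated against `w`, it contradicts the separation.
  have hx : ∀ x, |f (T fun i => u i x)| ≤ s / normM w := by
    intro x
    rw [le_div_iff₀ hpos, mul_comm]
    have h1 := hs _ (smul_mem_smul_set (a := normM w) (subset_convexHull ℝ _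
      (Or.inl (mem_insert_of_mem 0 ⟨x, rfl⟩) : (T fun i => u i x) ∈ atomSet u T)))
    have h2 := hs _ (smul_mem_smul_set (a := normM w) (subset_convexHull ℝ _
      (Or.inr (by
        rw [Set.mem_neg, neg_neg]
        exact mem_insert_of_mem 0 ⟨x, rfl⟩) : -(T fun i => u i x) ∈ atomSet u T)))
    rw [map_smul, smul_eq_mul] at h1 h2
    rw [map_neg] at h2
    rcases abs_cases (f (T fun i => u i x)) with ⟨h, -⟩ | ⟨h, -⟩ <;> rw [h]
    · exact h1.le
    · exact h2.le
  have hval := dual_moments u ((f : (Fin M → ℝ) →ₗ[ℝ] ℝ) ∘ₗ T) w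
  have hle : ‖∫ᵛ x, f (T fun i => u i x) ∂<•w‖ ≤ s / normM w * normM w := by
    refine (VectorMeasure.norm_integral_le_of_norm_le_const (Eventually.of_forall hx)).trans ?_
    rw [← normM_eq]
    have h1 : ‖(ContinuousLinearMap.lsmul ℝ ℝ : ℝ →L[ℝ] ℝ →L[ℝ] ℝ).flip‖ ≤ 1 := by
      rw [ContinuousLinearMap.opNorm_flip]
      exact ContinuousLinearMap.opNorm_lsmul_le
    have h2 : 0 ≤ s / normM w := (abs_nonneg _).trans (hx 0)
    have h3 := normM_nonneg w
    calc s / normM w * _ * normM w ≤ s / normM w * 1 * normM w := by gcongr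
      _ = _ := by ring
  rw [div_mul_cancel₀ _ hpos.ne'] at hle
  have : f (T (moments u w)) = ∫ᵛ x, f (T fun i => u i x) ∂<•w := hval
  rw [← this] at hle
  exact absurd ((le_abs_self _).trans hle) (not_le.2 hfs)

/-- Every point of the convex hull is attained by a finitely supported measure of norm at most
one. -/
lemma exists_finite_moments_eq (u : Fin M → C₀(Space d, ℝ))
    (T : (Fin M → ℝ) →ₗ[ℝ] (Fin M → ℝ)) {z : Fin M → ℝ}
    (hz : z ∈ convexHull ℝ (atomSet u T)) :
    ∃ (w : Meas d) (F : Finset (Space d)), w.variation (F : Set (Space d))ᶜ = 0 ∧ normM w ≤ 1 ∧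
      T (moments u w) = z := by
  classical
  -- `S` is convex and its moments include all atoms, so they include the whole hull.
  let S : Set (Meas d) :=
    {w | normM w ≤ 1 ∧ ∃ F : Finset (Space d), w.variation (F : Set (Space d))ᶜ = 0}
  have hS : Convex ℝ S := by
    rintro w₁ ⟨h₁, F₁, hF₁⟩ w₂ ⟨h₂, F₂, hF₂⟩ a b ha hb hab
    refine ⟨?_, F₁ ∪ F₂, ?_⟩
    · refine (normM_add_le _ _).trans ?_
      rw [normM_smul, normM_smul, abs_of_nonneg ha, abs_of_nonneg hb]
      nlinarith
    · refine le_antisymm ((VectorMeasure.variation_add_le _).trans ?_) bot_le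
      have e₁ : w₁.variation ((F₁ ∪ F₂ : Finset (Space d)) : Set (Space d))ᶜ = 0 :=
        measure_mono_null (compl_subset_compl.2 (by simp)) hF₁
      have e₂ : w₂.variation ((F₁ ∪ F₂ : Finset (Space d)) : Set (Space d))ᶜ = 0 :=
        measure_mono_null (compl_subset_compl.2 (by simp)) hF₂
      rw [Measure.add_apply, VectorMeasure.variation_smul, VectorMeasure.variation_smul,
        Measure.smul_apply, Measure.smul_apply, e₁, e₂]
      simp
  have hdirac : ∀ x : Space d, diracM x ∈ S := fun x =>
    ⟨(normM_diracM x).le, {x}, by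
      rw [diracM, VectorMeasure.variation_dirac]
      simp⟩
  have hneg : ∀ w ∈ S, -w ∈ S := fun w hw =>
    ⟨by
      rw [← neg_one_smul ℝ w, normM_smul]
      simpa using hw.1, hw.2.imp fun F hF => by rwa [VectorMeasure.variation_neg]⟩
  have hzero : (0 : Meas d) ∈ S := ⟨by rw [normM_zero]; exact zero_le_one, ∅, by simp⟩
  have hsub : atomSet u T ⊆ (T ∘ₗ moments u) '' S := by
    have h1 : ∀ z ∈ insert 0 (range fun x => T fun i => u i x), z ∈ (T ∘ₗ moments u) '' S := by
      rintro z (rfl | ⟨x, rfl⟩)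
      · exact ⟨0, hzero, map_zero _⟩
      · exact ⟨diracM x, hdirac x, by rw [LinearMap.comp_apply, moments_diracM]⟩
    rintro z (hz | hz)
    · exact h1 z hz
    · obtain ⟨w, hw, he⟩ := h1 (-z) hz
      exact ⟨-w, hneg w hw, by rw [map_neg, he, neg_neg]⟩
  obtain ⟨w, ⟨hw1, F, hF⟩, he⟩ := convexHull_min hsub (hS.linear_image _) hz
  exact ⟨w, F, hF, hw1, he⟩

/-- The minimal norm under finitely many moment constraints is attained by a finitely supported
measure. -/
theorem exists_finite_minimizer (u : Fin M → C₀(Space d, ℝ))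
    (T : (Fin M → ℝ) →ₗ[ℝ] (Fin M → ℝ)) (w₁ : Meas d) :
    ∃ (w₀ : Meas d) (F : Finset (Space d)), w₀.variation (F : Set (Space d))ᶜ = 0 ∧
      T (moments u w₀) = T (moments u w₁) ∧
      ∀ w, T (moments u w) = T (moments u w₁) → normM w₀ ≤ normM w := by
  set z := T (moments u w₁)
  set K := convexHull ℝ (atomSet u T)
  have hK : IsCompact K := isCompact_convexHull_atomSet u T
  -- The norm and the normalized moments are separate variables; capping the norm by that of the
  -- competitor `w₁` makes `Q` compact.
  let Q : Set (ℝ × (Fin M → ℝ)) := (Icc 0 (normM w₁) ×ˢ K) ∩ {q | q.1 • q.2 = z}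
  have hQ : IsCompact Q := (isCompact_Icc.prod hK).inter_right
    (isClosed_eq (by fun_prop) continuous_const)
  obtain ⟨k₁, hk₁, he₁⟩ := moments_mem_smul_convexHull u T w₁
  obtain ⟨⟨β, k⟩, ⟨⟨hβ, hk⟩, hβk⟩, hmin⟩ := hQ.exists_isMinOn
    ⟨(normM w₁, k₁), ⟨⟨normM_nonneg w₁, le_rfl⟩, hk₁⟩, he₁⟩ continuous_fst.continuousOn
  obtain ⟨w, F, hF, hw, hwk⟩ := exists_finite_moments_eq u T hk
  have hβ0 : 0 ≤ β := hβ.1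
  refine ⟨β • w, F, ?_, ?_, fun w' hw' => ?_⟩
  · rw [VectorMeasure.variation_smul, Measure.smul_apply, hF, smul_zero]
  · rw [map_smul, map_smul, hwk]
    exact hβk
  · have hle : normM (β • w) ≤ β := by
      rw [normM_smul, abs_of_nonneg hβ0]
      exact mul_le_of_le_one_right hβ0 hw
    refine hle.trans ?_
    rcases le_total (normM w') (normM w₁) with h | h
    · obtain ⟨k', hk', he'⟩ := moments_mem_smul_convexHull u T w'
      exact hmin (show (normM w', k') ∈ Q from ⟨⟨⟨normM_nonneg w', h⟩, hk'⟩, he'.trans hw'⟩)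
    · exact hβ.2.trans h

end Moments

/-! ### Reduction of the interpolation constraint to moments -/

section Constraint

variable {d M N₀ n : ℕ} {L : LSIOperator d}

/-- A weak*-continuous measurement operator is given by functions in `C₀` and by the functionals of
the biorthogonal system. -/
lemma exists_moments_of_continuous {φ : Fin N₀ → Module.Dual ℝ (nativeSpace L n)}
    {ν : nativeSpace L n →ₗ[ℝ] (Fin M → ℝ)} (hν : @Continuous _ _ (weakStar L n φ) _ ν) :
    ∃ (u : Fin M → C₀(Space d, ℝ)) (B : Fin M → Fin N₀ → ℝ), ∀ f i,
      ν f i = moments u (opL L n f) i + ∑ j, B i j * φ j f := by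
  have key : ∀ i, ∃ (u : C₀(Space d, ℝ)) (b : Fin N₀ → ℝ), ∀ f,
      ν f i = ∫ᵛ x, u x ∂<•(opL L n f) + ∑ j, b j * φ j f := by
    intro i
    have hmem : (LinearMap.proj i ∘ₗ ν : Module.Dual ℝ (nativeSpace L n)) ∈
        Submodule.span ℝ (range ((↑) : predual L n φ → Module.Dual ℝ (nativeSpace L n))) := by
      -- For a topology of pointwise convergence, the continuous linear functionals are exactly the
      -- span of the family.
      rw [LinearMap.mem_span_iff_continuous]
      have h : @Continuous _ _ (weakStar L n φ) _ (fun f => ν f i) :=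
        @Continuous.comp _ _ _ (weakStar L n φ) _ _ _ _ (continuous_apply i) hν
      convert! h using 1
      exact (induced_to_pi _).symm
    rw [Subtype.range_coe, Submodule.span_eq, predual, Submodule.mem_sup] at hmem
    obtain ⟨_, ⟨u, rfl⟩, ℓ, hℓ, he⟩ := hmem
    obtain ⟨b, rfl⟩ := (Submodule.mem_span_range_iff_exists_fun ℝ).1 hℓ
    refine ⟨u, b, fun f => ?_⟩
    have := LinearMap.congr_fun he f
    simp only [LinearMap.add_apply, LinearMap.sum_apply, LinearMap.smul_apply, smul_eq_mul] at this
    exact this.symm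
  choose u B h using key
  exact ⟨u, B, fun f i => h i f⟩

/-- Up to the null space, interpolation constraints are constraints on finitely many moments of
`Lf`. -/
lemma exists_moment_constraint {φ : Fin N₀ → Module.Dual ℝ (nativeSpace L n)}
    {p : Module.Basis (Fin N₀) ℝ (nullSpace L n)} (hφ : IsBiorthogonal φ p)
    {ν : nativeSpace L n →ₗ[ℝ] (Fin M → ℝ)} (hν : @Continuous _ _ (weakStar L n φ) _ ν) :
    ∃ (u : Fin M → C₀(Space d, ℝ)) (T : (Fin M → ℝ) →ₗ[ℝ] (Fin M → ℝ)),
      ∀ y, ∀ w ∈ LinearMap.range (opL L n),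
        (∃ f, opL L n f = w ∧ ν f = y) ↔ T (moments u w) = T y := by
  obtain ⟨u, B, hB⟩ := exists_moments_of_continuous hν
  set U := (nullSpace L n).map ν
  obtain ⟨V, hUV⟩ := Submodule.exists_isCompl U
  set T : (Fin M → ℝ) →ₗ[ℝ] (Fin M → ℝ) := V.subtype ∘ₗ V.projectionOnto U hUV.symm
  -- `T` forgets exactly what a null-space element can correct.
  have hT : ∀ v, T v = 0 ↔ v ∈ U := fun v => by
    rw [LinearMap.comp_apply, Submodule.subtype_apply, ZeroMemClass.coe_eq_zero,
      Submodule.projectionOnto_apply_eq_zero_iff]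
  have hnull : ∀ q ∈ nullSpace L n, opL L n q = 0 := fun q hq => hq
  have hp : ∀ i j, ν (p j) i = B i j := fun i j => by
    rw [hB, hnull _ (p j).2, map_zero]
    simp [hφ _ j]
  have hfu : ∀ f, T (moments u (opL L n f)) = T (ν f) := fun f => by
    rw [eq_comm, ← sub_eq_zero, ← map_sub, hT]
    refine ⟨∑ j, φ j f • (p j : nativeSpace L n),
      Submodule.sum_mem _ fun j _ => Submodule.smul_mem _ _ (p j).2, ?_⟩
    ext i
    rw [Pi.sub_apply, hB f i, add_sub_cancel_left, map_sum, Finset.sum_apply]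
    refine Finset.sum_congr rfl fun j _ => ?_
    rw [map_smul, Pi.smul_apply, hp, smul_eq_mul, mul_comm]
  refine ⟨u, T, ?_⟩
  rintro y _ ⟨f₀, rfl⟩
  constructor
  · rintro ⟨f, hf, rfl⟩
    rw [← hf, hfu]
  · intro h
    rw [hfu, eq_comm, ← sub_eq_zero, ← map_sub, hT] at h
    obtain ⟨q, hq, he⟩ := h
    refine ⟨f₀ + q, ?_, ?_⟩
    · rw [map_add, hnull q hq, add_zero]
    · rw [map_add, he, add_sub_cancel]

/-- If a convex combination of two measures of minimal norm is concentrated on a set, so are the two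
measures. -/
lemma variation_compl_eq_zero_of_combination {w w₁ w₂ : Meas d} {s : Set (Space d)}
    (hs : MeasurableSet s) (hw : w.variation sᶜ = 0) {a b : ℝ} (ha : 0 < a) (hb : 0 < b)
    (hab : a + b = 1) (he : a • w₁ + b • w₂ = w) (h₁ : normM w₁ ≤ normM w)
    (h₂ : normM w₂ ≤ normM w) : w₁.variation sᶜ = 0 := by
  have hsplit : ∀ w : Meas d, normM w = w.variation.real s + w.variation.real sᶜ := fun w => by
    rw [normM_eq, measureReal_add_measureReal_compl hs]
  have hw0 : w.variation.real sᶜ = 0 := by rw [measureReal_def, hw, ENNReal.toReal_zero]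
  have hle : w.variation.real s ≤ a * w₁.variation.real s + b * w₂.variation.real s := by
    rw [← he]
    refine (variation_real_add_le _ _ s).trans (le_of_eq ?_)
    rw [variation_real_smul, variation_real_smul, abs_of_pos ha, abs_of_pos hb]
  rw [hsplit w, hw0, add_zero, hsplit] at h₁ h₂
  have hp₁ : 0 ≤ w₁.variation.real sᶜ := measureReal_nonneg
  have hp₂ : 0 ≤ w₂.variation.real sᶜ := measureReal_nonneg
  -- On `s` the combination has all its mass, so any mass of `w₁` or `w₂` outside `s` would make the
  -- triangle inequality on `s` fail.
  have hz : w₁.variation.real sᶜ = 0 := by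
    have e₁ := mul_le_mul_of_nonneg_left h₁ ha.le
    have e₂ := mul_le_mul_of_nonneg_left h₂ hb.le
    have e₃ : a * w.variation.real s + b * w.variation.real s = w.variation.real s := by
      rw [← add_mul, hab, one_mul]
    have e₄ := mul_nonneg hb.le hp₂
    have e₅ := mul_nonneg ha.le hp₁
    have : a * w₁.variation.real sᶜ = 0 := by linarith
    exact (mul_eq_zero.1 this).resolve_left ha.ne'
  rwa [measureReal_eq_zero_iff] at hz

end Constraint

/-! ### Existence of extreme points -/

section Existence

variable {d M N₀ : ℕ} {L : LSIOperator d} {ρ : Space d → ℝ}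

/-- The solution set of the interpolation problem has extreme points. -/
theorem extremePoints_solutionSet_nonempty (hL : IsSplineAdmissible L ρ)
    {p : Module.Basis (Fin N₀) ℝ (nullSpace L (growthOrder ρ))}
    {φ : Fin N₀ → Module.Dual ℝ (nativeSpace L (growthOrder ρ))} (hφ : IsBiorthogonal φ p)
    {ν : nativeSpace L (growthOrder ρ) →ₗ[ℝ] (Fin M → ℝ)}
    (hν : @Continuous _ _ (weakStar L (growthOrder ρ) φ) _ ν)
    (hinj : ∀ q ∈ nullSpace L (growthOrder ρ), ν q = 0 → q = 0)
    {y : Fin M → ℝ} (hy : ∃ f, ν f = y) :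
    (extremePoints ℝ (solutionSet L (growthOrder ρ) ν y)).Nonempty := by
  obtain ⟨u, T, hT⟩ := exists_moment_constraint hφ hν
  obtain ⟨f₁, hf₁⟩ := hy
  have hTf : ∀ f, ν f = y → T (moments u (opL L (growthOrder ρ) f)) = T y := fun f hf =>
    (hT y _ ⟨f, rfl⟩).1 ⟨f, rfl, hf⟩
  obtain ⟨w₀, F, hF, hw₀, hmin⟩ := exists_finite_minimizer u T (opL L (growthOrder ρ) f₁)
  rw [hTf f₁ hf₁] at hw₀ hmin
  -- `w₀` is minimal among all measures, in the range of `L` or not, so its norm bounds `gTV` from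
  -- below.
  have hmin' : ∀ f, ν f = y → normM w₀ ≤ gTV L (growthOrder ρ) f := fun f hf => hmin _ (hTf f hf)
  let m : (F → ℝ) →ₗ[ℝ] Meas d := Fintype.linearCombination ℝ fun x : F => diracM (x : Space d)
  have hm : ∀ a, m a = ∑ x : F, a x • diracM (x : Space d) := fun a =>
    Fintype.linearCombination_apply ℝ _ a
  have hm' : ∀ a : Space d → ℝ, m (fun x => a x) = ∑ x ∈ F, a x • diracM x := fun a => by
    rw [hm]
    exact Finset.sum_coe_sort F fun x => a x • diracM x
  have hmrange : ∀ a, m a ∈ LinearMap.range (opL L (growthOrder ρ)) := fun a => by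
    rw [hm]
    refine Submodule.sum_mem _ fun x _ => Submodule.smul_mem _ _ ?_
    obtain ⟨f, -, hf⟩ := hL.exists_opL_eq_diracM (x : Space d)
    exact ⟨f, hf⟩
  have hmapply : ∀ a (x : F), m a {(x : Space d)} = a x := fun a x => by
    classical
    rw [hm, sum_meas_apply, Finset.sum_eq_single x]
    · simp [diracM]
    · intro x' _ hx'
      simp [diracM, Subtype.coe_injective.ne hx']
    · simp
  have hmvar : ∀ a, (m a).variation (F : Set (Space d))ᶜ = 0 := fun a => by
    classical
    obtain ⟨a', rfl⟩ : ∃ a' : Space d → ℝ, (fun x : F => a' x) = a :=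
      ⟨fun t => if h : t ∈ F then a ⟨t, h⟩ else 0, by
        ext x
        simp⟩
    rw [hm']
    exact variation_sum_diracM_compl F _
  have hmnorm : ∀ a, normM (m a) ≤ ∑ x, |a x| := fun a => by
    rw [hm]
    refine (normM_sum_le _ _).trans (Finset.sum_le_sum fun x _ => ?_)
    rw [normM_smul, normM_diracM, mul_one]
  -- Coefficient vectors of the minimizers carried by `F`; the problem becomes finite-dimensional.
  let S : Set (F → ℝ) := {a | T (moments u (m a)) = T y ∧ ∑ x, |a x| ≤ normM w₀}
  have hS : ∀ w : Meas d, T (moments u w) = T y → w.variation (F : Set (Space d))ᶜ = 0 →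
      normM w ≤ normM w₀ → m (fun x => w {(x : Space d)}) = w ∧
        (fun x : F => w {(x : Space d)}) ∈ S := by
    intro w hw hwF hle
    have h1 : m (fun x => w {(x : Space d)}) = w := by
      rw [hm' fun x => w {x}]
      exact (eq_sum_diracM w F hwF).symm
    refine ⟨h1, by rwa [h1], ?_⟩
    rw [normM_eq_sum_abs w F hwF] at hle
    exact (Finset.sum_coe_sort F fun x => |w {x}|).trans_le hle
  have hScomp : IsCompact S := by
    refine Metric.isCompact_of_isClosed_isBounded ?_ ?_
    · have hc : Continuous (T ∘ₗ moments u ∘ₗ m) := LinearMap.continuous_of_finiteDimensional _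
      exact (isClosed_eq hc continuous_const).inter (isClosed_le
        (by fun_prop : Continuous fun a : F → ℝ => ∑ x, |a x|) continuous_const)
    · refine (Metric.isBounded_closedBall (x := (0 : F → ℝ)) (r := normM w₀)).subset
        fun a ha => ?_
      rw [mem_closedBall_zero_iff, pi_norm_le_iff_of_nonneg (normM_nonneg _)]
      exact fun x => (Finset.single_le_sum (f := fun x => |a x|) (fun _ _ => abs_nonneg _)
        (Finset.mem_univ x)).trans ha.2
  obtain ⟨a, ha⟩ := hScomp.extremePoints_nonempty ⟨_, (hS w₀ hw₀ hF le_rfl).2⟩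
  obtain ⟨f, hf, hfy⟩ := (hT y (m a) (hmrange a)).2 ha.1.1
  have hfle : gTV L (growthOrder ρ) f ≤ normM w₀ := by
    rw [gTV, hf]
    exact (hmnorm a).trans ha.1.2
  have hfV : f ∈ solutionSet L (growthOrder ρ) ν y := ⟨hfy, fun g hg => hfle.trans (hmin' g hg)⟩
  refine ⟨f, mem_extremePoints_iff_left.2 ⟨hfV, fun g₁ hg₁ g₂ hg₂ hseg => ?_⟩⟩
  obtain ⟨s, t, hs, ht, hst, hcomb⟩ := hseg
  have hcomb' : s • opL L (growthOrder ρ) g₁ + t • opL L (growthOrder ρ) g₂ = m a := by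
    rw [← hf, ← hcomb, map_add, map_smul, map_smul]
  have hn : ∀ g ∈ solutionSet L (growthOrder ρ) ν y,
      normM (opL L (growthOrder ρ) g) ≤ normM (m a) := fun g hg => by
    rw [← hf]
    exact hg.2 f hfy
  have hn' : normM (m a) ≤ normM w₀ := (hmnorm a).trans ha.1.2
  -- Both ends of the segment have images carried by `F`, so extremality of `a` in `S` applies to
  -- them.
  have hv₁ := variation_compl_eq_zero_of_combination F.measurableSet (hmvar a) hs ht hst hcomb'
    (hn g₁ hg₁) (hn g₂ hg₂)
  have hv₂ := variation_compl_eq_zero_of_combination F.measurableSet (hmvar a) ht hs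
    ((add_comm t s).trans hst) ((add_comm _ _).trans hcomb') (hn g₂ hg₂) (hn g₁ hg₁)
  obtain ⟨e₁, m₁⟩ := hS _ (hTf g₁ hg₁.1) hv₁ ((hn g₁ hg₁).trans hn')
  obtain ⟨e₂, m₂⟩ := hS _ (hTf g₂ hg₂.1) hv₂ ((hn g₂ hg₂).trans hn')
  have ha' := (mem_extremePoints_iff_left.1 ha).2 _ m₁ _ m₂ ⟨s, t, hs, ht, hst, by
    ext x
    rw [← hmapply a x, ← hcomb']
    simp⟩
  rw [ha'] at e₁
  rw [← sub_eq_zero]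
  -- `g₁` and `f` have the same image and the same measurements.
  refine hinj _ ?_ ?_
  · change opL L (growthOrder ρ) (g₁ - f) = 0
    rw [map_sub, hf, e₁, sub_self]
  · rw [map_sub, hg₁.1, hfy, sub_self]

end Existence

/-! ### Extreme points have finitely supported images -/

section ExtremePoints

variable {d M N₀ : ℕ} {L : LSIOperator d} {ρ : Space d → ℝ}

/-- Nonzero restrictions of a measure to disjoint sets are linearly independent. -/
lemma linearIndependent_restrict {ι : Type*} [Fintype ι] (w : Meas d) {A : ι → Set (Space d)}
    (hA : ∀ i, MeasurableSet (A i)) (hd : Pairwise (Function.onFun Disjoint A))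
    (hpos : ∀ i, w.variation (A i) ≠ 0) : LinearIndependent ℝ fun i => w.restrict (A i) := by
  rw [Fintype.linearIndependent_iff]
  intro c hc i
  have hi := hpos i
  rw [Ne, VectorMeasure.variation_apply_eq_zero (hA i)] at hi
  push Not at hi
  -- Evaluation on `E`, inside `A i` with `w E ≠ 0`, isolates the coefficient `c i`.
  obtain ⟨E, hEA, hE, hwE⟩ := hi
  have h : (∑ j, c j • w.restrict (A j)) E = (0 : Meas d) E := by rw [hc]
  rw [sum_meas_apply, Finset.sum_eq_single i, FunLike.coe_zero, Pi.zero_apply] at h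
  · rw [_root_.smul_apply, VectorMeasure.restrict_eq_self _ (hA i) hE hEA, smul_eq_mul] at h
    exact (mul_eq_zero.1 h).resolve_right hwE
  · intro j _ hj
    rw [_root_.smul_apply, VectorMeasure.restrict_apply _ (hA j) hE,
      ((hd hj.symm).mono_left hEA).inter_eq, VectorMeasure.empty, smul_zero]
  · simp

/-- An extreme point of the solution set admits no admissible perturbation by multiples of
restrictions of its image to disjoint sets. -/
lemma eq_zero_of_opL_eq_sum_restrict {n : ℕ} {ν : nativeSpace L n →ₗ[ℝ] (Fin M → ℝ)}
    {y : Fin M → ℝ} {s : nativeSpace L n} (hs : s ∈ extremePoints ℝ (solutionSet L n ν y))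
    {ι : Type*} [Fintype ι] {A : ι → Set (Space d)} (hA : ∀ i, MeasurableSet (A i))
    (hd : Pairwise (Function.onFun Disjoint A)) {g : nativeSpace L n} (hνg : ν g = 0)
    {c : ι → ℝ} (hg : opL L n g = ∑ i, c i • (opL L n s).restrict (A i)) : g = 0 := by
  -- Small enough that `|ε c i| ≤ 1`; the summand `1` keeps it positive when all `c i` vanish.
  set ε : ℝ := (1 + ∑ i, |c i|)⁻¹
  have hsum : 0 ≤ ∑ i, |c i| := Finset.sum_nonneg fun _ _ => abs_nonneg _
  have hε : 0 < ε := by positivity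
  have hεc : ∀ i, |ε * c i| ≤ 1 := fun i => by
    rw [abs_mul, abs_of_pos hε, inv_mul_le_one₀ (by positivity)]
    have := Finset.single_le_sum (f := fun i => |c i|) (fun _ _ => abs_nonneg _)
      (Finset.mem_univ i)
    linarith
  set κ := ∑ i, ε * c i * (opL L n s).variation.real (A i)
  have hbound : ∀ t : ℝ, |t| = 1 → gTV L n (s + (t * ε) • g) ≤ gTV L n s + t * κ := by
    intro t ht
    rw [gTV, gTV, map_add, map_smul, hg, Finset.smul_sum]
    simp only [smul_smul]
    refine (normM_add_sum_restrict_le _ Finset.univ A (fun i _ => hA i)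
      (hd.pairwiseDisjoint _) (fun i => t * ε * c i) fun i _ => ?_).trans (le_of_eq ?_)
    · rw [mul_assoc, abs_mul, ht, one_mul]
      exact hεc i
    · simp only [κ, Finset.mul_sum, mul_assoc]
  obtain ⟨hsV, hext⟩ := mem_extremePoints_iff_left.1 hs
  have hy : ∀ t : ℝ, ν (s + (t * ε) • g) = y := fun t => by
    rw [map_add, map_smul, hνg, smul_zero, add_zero, hsV.1]
  have h₁ := hbound 1 abs_one
  have h₂ := hbound (-1) (by simp)
  have hκ₁ := hsV.2 _ (hy 1)
  have hκ₂ := hsV.2 _ (hy (-1))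
  -- The bounds at `t = 1` and `t = -1`, with minimality of `s`, force `κ = 0`. So `s ± εg` are both
  -- solutions, with midpoint `s`.
  have hfix := hext (s + ((1 : ℝ) * ε) • g)
    ⟨hy 1, fun h hh => by linarith [hsV.2 h hh]⟩ (s + ((-1 : ℝ) * ε) • g)
    ⟨hy (-1), fun h hh => by linarith [hsV.2 h hh]⟩
    ⟨1 / 2, 1 / 2, by norm_num, by norm_num, by norm_num, by module⟩
  rw [add_eq_left, one_mul, smul_eq_zero] at hfix
  exact hfix.resolve_left hε.ne'

lemma linearIndependent_coe_basis {ι V : Type*} [AddCommGroup V] [Module ℝ V] {N : Submodule ℝ V}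
    (p : Module.Basis ι ℝ N) : LinearIndependent ℝ fun j => (p j : V) :=
  p.linearIndependent.map' N.subtype N.ker_subtype

/-- The support of `Ls`, for an extreme point `s` of the solution set, has at most `M - N₀`
points. -/
theorem card_add_le_of_subset_support (hL : IsSplineAdmissible L ρ)
    (p : Module.Basis (Fin N₀) ℝ (nullSpace L (growthOrder ρ)))
    {ν : nativeSpace L (growthOrder ρ) →ₗ[ℝ] (Fin M → ℝ)} {y : Fin M → ℝ}
    {s : nativeSpace L (growthOrder ρ)}
    (hs : s ∈ extremePoints ℝ (solutionSet L (growthOrder ρ) ν y)) (F : Finset (Space d))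
    (hF : (F : Set (Space d)) ⊆ (opL L (growthOrder ρ) s).variation.support) :
    F.card + N₀ ≤ M := by
  obtain ⟨U, hU, hdisj⟩ := F.finite_toSet.t2_separation
  -- The unit balls make the sets bounded, as the lift of a restriction requires.
  let A : F → Set (Space d) := fun x => U x ∩ Metric.ball (x : Space d) 1
  have hAm : ∀ x, MeasurableSet (A x) := fun x =>
    ((hU x).2.inter Metric.isOpen_ball).measurableSet
  have hAd : Pairwise (Function.onFun Disjoint A) := fun x x' hxx' =>
    (hdisj x.2 x'.2 (Subtype.coe_injective.ne hxx')).mono inter_subset_left inter_subset_left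
  have hApos : ∀ x, (opL L (growthOrder ρ) s).variation (A x) ≠ 0 := fun x =>
    ((Measure.mem_support_iff_forall (x : Space d)).1 (hF x.2) _
      (((hU x).2.inter Metric.isOpen_ball).mem_nhds
        ⟨(hU x).1, Metric.mem_ball_self one_pos⟩)).ne'
  choose f hf using fun x => hL.exists_opL_eq_restrict (opL L (growthOrder ρ) s) (hAm x)
    (R := ‖(x : Space d)‖ + 1) (inter_subset_right.trans fun t ht => by
      rw [mem_closedBall_zero_iff]
      have h1 := norm_sub_norm_le t (x : Space d)
      have h2 := mem_ball_iff_norm.1 ht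
      linarith)
  have hw := linearIndependent_restrict _ hAm hAd hApos
  have hpli : LinearIndependent ℝ fun j => (p j : nativeSpace L (growthOrder ρ)) :=
    linearIndependent_coe_basis p
  have hLp : ∀ j, opL L (growthOrder ρ) (p j : nativeSpace L (growthOrder ρ)) = 0 :=
    fun j => LinearMap.mem_ker.1 (p j).2
  let G : (F → ℝ) × (Fin N₀ → ℝ) →ₗ[ℝ] nativeSpace L (growthOrder ρ) :=
    (Fintype.linearCombination ℝ f).coprod
      (Fintype.linearCombination ℝ fun j => (p j : nativeSpace L (growthOrder ρ)))
  have hG : ∀ v, G v = ∑ x, v.1 x • f x +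
      ∑ j, v.2 j • (p j : nativeSpace L (growthOrder ρ)) := fun v => by
    rw [LinearMap.coprod_apply, Fintype.linearCombination_apply, Fintype.linearCombination_apply]
  have hLG : ∀ v, opL L (growthOrder ρ) (G v) =
      ∑ x, v.1 x • (opL L (growthOrder ρ) s).restrict (A x) := fun v => by
    rw [hG, map_add, map_sum, map_sum]
    simp only [map_smul, hLp, hf, smul_zero, Finset.sum_const_zero, add_zero]
  -- Injectivity of `ν ∘ G` into `ℝ^M` is the dimension count `|F| + N₀ ≤ M`.
  have hker : LinearMap.ker (ν ∘ₗ G) = ⊥ := by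
    refine (Submodule.eq_bot_iff _).2 fun v hv => ?_
    have hGv : G v = 0 := eq_zero_of_opL_eq_sum_restrict hs hAm hAd hv (hLG v)
    have h1 : v.1 = 0 := by
      ext x
      refine Fintype.linearIndependent_iff.1 hw v.1 ?_ x
      rw [← hLG, hGv, map_zero]
    refine Prod.ext h1 ?_
    rw [hG, h1] at hGv
    simp only [Pi.zero_apply, zero_smul, Finset.sum_const_zero, zero_add] at hGv
    ext j
    exact Fintype.linearIndependent_iff.1 hpli v.2 hGv j
  have hfin := LinearMap.finrank_le_finrank_of_injective (LinearMap.ker_eq_bot.1 hker)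
  simpa using hfin

lemma coeFn_sum_smul {n : ℕ} {ι : Type*} (F : Finset ι) (c : ι → ℝ) (f : ι → nativeSpace L n) :
    (((∑ i ∈ F, c i • f i : nativeSpace L n) : Space d →ₘ[volume] ℝ) : Space d → ℝ) =ᵐ[volume]
      fun t => ∑ i ∈ F, c i * (f i : Space d →ₘ[volume] ℝ) t := by
  classical
  induction F using Finset.induction_on with
  | empty =>
    simp only [Finset.sum_empty]
    exact AEEqFun.coeFn_zero
  | insert i F hi ih =>
    simp only [Finset.sum_insert hi]
    filter_upwards [ih, AEEqFun.coeFn_add (c i • f i : nativeSpace L n).1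
      (∑ i ∈ F, c i • f i : nativeSpace L n).1, AEEqFun.coeFn_smul (c i) (f i).1] with t h1 h2 h3
    refine h2.trans ?_
    rw [Pi.add_apply, h1]
    congr 1

end ExtremePoints

end GTV

end

/-! ### The representation theorem -/

theorem theorem2 {d M N₀ : ℕ} (L : GTV.LSIOperator d) (ρ : GTV.Space d → ℝ)
    (hL : GTV.IsSplineAdmissible L ρ)
    (p : Module.Basis (Fin N₀) ℝ (GTV.nullSpace L (GTV.growthOrder ρ)))
    (φ : Fin N₀ → Module.Dual ℝ (GTV.nativeSpace L (GTV.growthOrder ρ)))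
    (hφ : GTV.IsBiorthogonal φ p)
    (ν : GTV.nativeSpace L (GTV.growthOrder ρ) →ₗ[ℝ] (Fin M → ℝ))
    (hν : @Continuous _ _ (GTV.weakStar L (GTV.growthOrder ρ) φ) _ ν)
    (hwell : ∀ q₁ ∈ GTV.nullSpace L (GTV.growthOrder ρ),
      ∀ q₂ ∈ GTV.nullSpace L (GTV.growthOrder ρ), ν q₁ = ν q₂ ↔ q₁ = q₂)
    (y : Fin M → ℝ) (hy : ∃ f, ν f = y) :
    (Set.extremePoints ℝ (GTV.solutionSet L (GTV.growthOrder ρ) ν y)).Nonempty ∧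
    ∀ s ∈ Set.extremePoints ℝ (GTV.solutionSet L (GTV.growthOrder ρ) ν y),
      ∃ (K : ℕ) (x : Fin K → GTV.Space d) (a : Fin K → ℝ) (b : Fin N₀ → ℝ),
        K + N₀ ≤ M ∧ Function.Injective x ∧
        (∀ᵐ t ∂MeasureTheory.volume, (s : GTV.Space d →ₘ[MeasureTheory.volume] ℝ) t =
          ∑ k, a k * ρ (t - x k) +
            ∑ n, b n * ((p n : GTV.nativeSpace L (GTV.growthOrder ρ)) :
              GTV.Space d →ₘ[MeasureTheory.volume] ℝ) t) ∧
        GTV.opL L (GTV.growthOrder ρ) s = ∑ k, a k • GTV.diracM (x k) ∧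
        GTV.gTV L (GTV.growthOrder ρ) s = ∑ k, |a k| := by
  have hinj : ∀ q ∈ GTV.nullSpace L (GTV.growthOrder ρ), ν q = 0 → q = 0 := fun q hq h =>
    (hwell q hq 0 (Submodule.zero_mem _)).1 (by rw [h, map_zero])
  refine ⟨GTV.extremePoints_solutionSet_nonempty hL hφ hν hinj hy, fun s hs => ?_⟩
  set w := GTV.opL L (GTV.growthOrder ρ) s
  have hcard : ∀ F : Finset (GTV.Space d), (F : Set (GTV.Space d)) ⊆ w.variation.support →
      F.card + N₀ ≤ M := GTV.card_add_le_of_subset_support hL p hs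
  have hfin : w.variation.support.Finite := by
    by_contra hinf
    obtain ⟨F, hF, hFc⟩ := Set.Infinite.exists_subset_card_eq hinf (M + 1)
    have := hcard F hF
    omega
  set F := hfin.toFinset
  have hFs : (F : Set (GTV.Space d)) = w.variation.support := hfin.coe_toFinset
  have hF0 : w.variation (F : Set (GTV.Space d))ᶜ = 0 := by
    rw [hFs]
    exact Measure.measure_compl_support
  let e : Fin F.card ≃ F := F.equivFin.symm
  have hsum : ∀ {β : Type} [AddCommMonoid β] (h : GTV.Space d → β),
      ∑ x ∈ F, h x = ∑ k, h (e k) := fun h => by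
    rw [← Finset.sum_coe_sort F h, ← e.sum_comp]
  have hw : w = ∑ k, w {(e k : GTV.Space d)} • GTV.diracM (e k : GTV.Space d) :=
    (GTV.eq_sum_diracM w F hF0).trans (hsum fun x => w {x} • GTV.diracM x)
  choose r hr hLr using fun k => hL.exists_opL_eq_diracM (e k : GTV.Space d)
  -- Subtracting the translates of `ρ` with the point masses of `Ls` as weights leaves an element of
  -- the null space, which the basis `p` expands.
  have hq : s - ∑ k, w {(e k : GTV.Space d)} • r k ∈ GTV.nullSpace L (GTV.growthOrder ρ) := by
    change GTV.opL L (GTV.growthOrder ρ) _ = 0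
    rw [map_sub, map_sum, sub_eq_zero]
    refine hw.trans (Finset.sum_congr rfl fun k _ => ?_)
    rw [map_smul, hLr]
  set b := p.repr ⟨_, hq⟩
  have hsb : s = ∑ k, w {(e k : GTV.Space d)} • r k +
      ∑ j, b j • (p j : GTV.nativeSpace L (GTV.growthOrder ρ)) := by
    have h := congrArg (Subtype.val) (p.sum_repr ⟨_, hq⟩)
    push_cast at h
    rw [h, add_sub_cancel]
  refine ⟨F.card, fun k => e k, fun k => w {(e k : GTV.Space d)}, b, hcard F hFs.le,
    Subtype.coe_injective.comp e.injective, ?_, hw,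
    (GTV.normM_eq_sum_abs w F hF0).trans (hsum fun x => |w {x}|)⟩
  have h₀ := AEEqFun.coeFn_add
    (∑ k, w {(e k : GTV.Space d)} • r k : GTV.nativeSpace L (GTV.growthOrder ρ)).1
    (∑ j, b j • (p j : GTV.nativeSpace L (GTV.growthOrder ρ)) :
      GTV.nativeSpace L (GTV.growthOrder ρ)).1
  filter_upwards [h₀, GTV.coeFn_sum_smul Finset.univ (fun k => w {(e k : GTV.Space d)}) r,
    GTV.coeFn_sum_smul Finset.univ b fun j => (p j : GTV.nativeSpace L (GTV.growthOrder ρ)),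
    ae_all_iff.2 hr] with t h1 h2 h3 h4
  have h5 : (s : GTV.Space d →ₘ[volume] ℝ) t = _ :=
    (congrArg (fun f : GTV.nativeSpace L (GTV.growthOrder ρ) =>
      (f : GTV.Space d →ₘ[volume] ℝ) t) hsb).trans h1
  rw [h5, Pi.add_apply, h2, h3]
  simp only [h4]
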